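/- A Souslin algebra is a (nontrivial) complete, atomless Boolean algebra that satisfies the countable chain condition and is $\aleph_0$-distributive, i.e. $\prod_{i\in\omega}\sum_{j\in J}a_{ij}=\sum_{f\in{}^{\omega}J}\prod_{i\in\omega}a_{i f(i)}$ for every index set $J$ and every family $(a_{ij})_{i\in\omega,\,j\in J}$. It is small if it has a set of complete generators of cardinality $\aleph_1$, i.e. a subset of cardinality $\aleph_1$ such that the only complete subalgebra containing it is the whole algebra. It is chain homogeneous if any two of its maximal chains (with respect to the Boolean order) are order isomorphic. A Souslin subalgebra of a Souslin algebra is a complete (i.e. closed under the joins and meets of the big algebra), atomless Boolean subalgebra. **Proposition 6.1.** Let $\mathbb{B}$ be a small and chain homogeneous Souslin algebra. Then $\mathbb{B}$ is homogeneous in the following strong sense: for all Souslin subalgebras $\mathbb{A}_0,\mathbb{A}_1$ of $\mathbb{B}$ and all $x\in\mathbb{A}_0$, $y\in\mathbb{A}_1$ with $0<x<1$ and $0<y<1$, the set of Boolean isomorphisms $\varphi:\mathbb{A}_0\to\mathbb{A}_1$ with $\varphi(x)=y$ has cardinality exactly $2^{\aleph_1}$. -/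

import Mathlib

open scoped Cardinal

universe u

/-- A partial order with least element is atomless if it has no atoms. -/
def Atomless (P : Type u) [PartialOrder P] [OrderBot P] : Prop :=
  ∀ a : P, ¬ IsAtom a

/-- The countable chain condition: every family of pairwise disjoint elements is countable. -/
def CountableChainCondition (B : Type u) [BooleanAlgebra B] : Prop :=
  ∀ X : Set B, X.PairwiseDisjoint id → X.Countable

/-- `ℵ₀`-distributivity: countable meets distribute over arbitrary joins. Index types `J` in the
universe of `B` are general enough, because a family `a` may be reindexed by the set of the
sequences `i ↦ a i j`, which is a subset of `ℕ → B`. -/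
def AlephZeroDistributive (B : Type u) [CompleteBooleanAlgebra B] : Prop :=
  ∀ (J : Type u) (a : ℕ → J → B), ⨅ i, ⨆ j, a i j = ⨆ f : ℕ → J, ⨅ i, a i (f i)

/-- A Souslin algebra is a (nontrivial) complete, atomless, c.c.c. and `ℵ₀`-distributive
Boolean algebra. -/
structure IsSouslinAlgebra (B : Type u) [CompleteBooleanAlgebra B] : Prop where
  nontrivial : Nontrivial B
  atomless : Atomless B
  ccc : CountableChainCondition B
  distributive : AlephZeroDistributive B

/-- A Boolean subalgebra is a complete subalgebra of `B` if it is closed under the joins of `B`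
(and hence, taking complements, also under the meets of `B`). -/
def IsCompleteSubalgebra {B : Type u} [CompleteBooleanAlgebra B] (A : BooleanSubalgebra B) : Prop :=
  ∀ S : Set B, S ⊆ (A : Set B) → sSup S ∈ A

/-- The subalgebra completely generated by `X`: the intersection of all complete subalgebras
that contain `X`. -/
def completelyGenerated {B : Type u} [CompleteBooleanAlgebra B] (X : Set B) :
    BooleanSubalgebra B :=
  sInf {A | IsCompleteSubalgebra A ∧ X ⊆ (A : Set B)}

/-- `B` is small if it has a set of complete generators of cardinality `ℵ₁`. -/
def IsSmallAlgebra (B : Type u) [CompleteBooleanAlgebra B] : Prop :=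
  ∃ X : Set B, #X = Cardinal.aleph 1 ∧ completelyGenerated X = ⊤

/-- `B` is chain homogeneous if any two maximal chains of `B` are order isomorphic. -/
def ChainHomogeneous (B : Type u) [BooleanAlgebra B] : Prop :=
  ∀ K₀ K₁ : Set B, IsMaxChain (· ≤ ·) K₀ → IsMaxChain (· ≤ ·) K₁ → Nonempty (K₀ ≃o K₁)

/-- A Souslin subalgebra of a Souslin algebra is a complete and atomless subalgebra (atoms being
those of the subalgebra); the countable chain condition and distributivity pass to complete
subalgebras. -/
structure IsSouslinSubalgebra {B : Type u} [CompleteBooleanAlgebra B]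
    (A : BooleanSubalgebra B) : Prop where
  complete : IsCompleteSubalgebra A
  atomless : Atomless A

/-! ### Maximal chains of intervals: cutting, gluing and translating them. -/

section Chains

open Set

variable {α : Type*} {β : Type*}

/-! Call a maximal chain interval dense if the differences `q \ p` of its members are dense. An
order isomorphism between two such chains extends to an isomorphism of the algebras, because
disjointness of differences can be read off the order of their end points
(`exists_orderIso_extend`). So the lower bound needs one such chain of `A₀` through `x`, `2 ^ ℵ₁`
such chains of `A₁` through `y`, and order isomorphisms sending `x` to `y`: the fixed chain is
carried to different targets by different isomorphisms.

The order isomorphisms come from chain homogeneity of `B`. By atomlessness, maximal chains of a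
Souslin subalgebra stay maximal in `B` (`IsSouslinSubalgebra.maxChainIn_image`). To match `x` with
`y`, the parts below and above them must be isomorphic, so homogeneity has to pass to nontrivial
intervals (`IsSouslinAlgebra.sameType_of_maxChainIn`). For this one finds an order type `I` carried
by chains below densely many elements. Below every nonzero element there is then a maximal chain
made of `ω` consecutive copies of `I` and a top, and every maximal chain of an interval has a final
segment of this type. Re-realising that segment elsewhere turns the chain of the interval into a
maximal chain of `B` of the same type.

The dense chains come from smallness, which yields a dense set of size at most `ℵ₁`
(`IsSmallAlgebra.exists_dense`). Its members, enumerated along `ω₁`, act as binary digits. The cuts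
of the lexicographic order of the branches form a chain, and any maximal chain containing them is
interval dense. Reversing digits at uncountably many indices gives the `2 ^ ℵ₁` chains.

For the upper bound, an isomorphism is determined on a dense set of size at most `ℵ₁`, and `A₁` has
at most `2 ^ ℵ₁` elements. -/

theorem exists_orderIso_of_rel [PartialOrder α] [PartialOrder β] {C : Set α} {D : Set β}
    (hC : IsChain (· ≤ ·) C) (hD : IsChain (· ≤ ·) D) (R : α → β → Prop)
    (hl : ∀ x ∈ C, ∃ y ∈ D, R x y) (hr : ∀ y ∈ D, ∃ x ∈ C, R x y)
    (h₁ : ∀ x ∈ C, ∀ x' ∈ C, ∀ y ∈ D, ∀ y' ∈ D, R x y → R x' y' → x < x' → y < y')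
    (h₂ : ∀ x ∈ C, ∀ x' ∈ C, ∀ y ∈ D, ∀ y' ∈ D, R x y → R x' y' → y < y' → x < x') :
    ∃ f : C ≃o D, ∀ x : C, R x (f x) := by
  have hl' : ∀ x : C, ∃ y : D, R x y := fun x => by
    obtain ⟨y, hy, h⟩ := hl x x.2
    exact ⟨⟨y, hy⟩, h⟩
  choose f hf using hl'
  have key : ∀ x x' : C, x < x' → f x < f x' := fun x x' h =>
    h₁ x x.2 x' x'.2 _ (f x).2 _ (f x').2 (hf x) (hf x') h
  have htri : ∀ x x' : C, x < x' ∨ x = x' ∨ x' < x := fun x x' => by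
    rcases hC.total x.2 x'.2 with h | h
    · rcases h.lt_or_eq with h | h
      · exact Or.inl h
      · exact Or.inr (Or.inl (Subtype.ext h))
    · rcases h.lt_or_eq with h | h
      · exact Or.inr (Or.inr h)
      · exact Or.inr (Or.inl (Subtype.ext h.symm))
  have hinj : Function.Injective f := fun x x' h => by
    rcases htri x x' with h' | h' | h'
    · exact absurd h (key _ _ h').ne
    · exact h'
    · exact absurd h.symm (key _ _ h').ne
  have hsurj : Function.Surjective f := fun y => by
    obtain ⟨x, hx, hxy⟩ := hr y y.2
    refine ⟨⟨x, hx⟩, Subtype.ext ?_⟩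
    have h0 := hf ⟨x, hx⟩
    rcases hD.total (f ⟨x, hx⟩).2 y.2 with h | h
    · rcases h.lt_or_eq with h | h
      · exact absurd (h₂ x hx x hx _ (f _).2 _ y.2 h0 hxy h) (lt_irrefl _)
      · exact h
    · rcases h.lt_or_eq with h | h
      · exact absurd (h₂ x hx x hx _ y.2 _ (f _).2 hxy h0 h) (lt_irrefl _)
      · exact h.symm
  refine ⟨⟨Equiv.ofBijective f ⟨hinj, hsurj⟩, ?_⟩, hf⟩
  intro x x'
  change f x ≤ f x' ↔ x ≤ x'
  constructor
  · intro h
    rcases htri x x' with h' | h' | h'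
    · exact h'.le
    · exact h'.le
    · exact absurd h (key _ _ h').not_ge
  · intro h
    rcases h.lt_or_eq with h | h
    · exact (key _ _ h).le
    · rw [h]

/-- Chains covered by linearly ordered families of isomorphic pieces are isomorphic. -/
theorem exists_orderIso_of_pieces [PartialOrder α] [PartialOrder β] {ι : Type*} [LinearOrder ι]
    {C : Set α} {D : Set β} (hC : IsChain (· ≤ ·) C) (hD : IsChain (· ≤ ·) D)
    (R : ι → α → β → Prop)
    (hl : ∀ x ∈ C, ∃ i, ∃ y ∈ D, R i x y) (hr : ∀ y ∈ D, ∃ i, ∃ x ∈ C, R i x y)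
    (hR : ∀ i x x' y y', R i x y → R i x' y' → (x < x' ↔ y < y'))
    (hlt : ∀ i j x x' y y', i < j → R i x y → R j x' y' → x ≤ x' ∧ y ≤ y' ∧ (x = x' ↔ y = y')) :
    ∃ f : C ≃o D, ∀ i x y (hx : x ∈ C), y ∈ D → R i x y → (f ⟨x, hx⟩ : β) = y := by
  have key : ∀ i j x x' y y', R i x y → R j x' y' → (x < x' ↔ y < y') := by
    intro i j x x' y y' h h'
    rcases lt_trichotomy i j with hij | rfl | hij
    · obtain ⟨h1, h2, h3⟩ := hlt i j x x' y y' hij h h'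
      rw [lt_iff_le_and_ne, lt_iff_le_and_ne, and_iff_right h1, and_iff_right h2, ne_eq, ne_eq, not_congr h3]
    · exact hR i x x' y y' h h'
    · obtain ⟨h1, h2, h3⟩ := hlt j i x' x y' y hij h' h
      exact iff_of_false h1.not_gt h2.not_gt
  obtain ⟨f, hf⟩ := exists_orderIso_of_rel hC hD (fun x y => ∃ i, R i x y)
    (fun x hx => let ⟨i, y, hy, h⟩ := hl x hx; ⟨y, hy, i, h⟩)
    (fun y hy => let ⟨i, x, hx, h⟩ := hr y hy; ⟨x, hx, i, h⟩)
    (fun x _ x' _ y _ y' _ ⟨i, h⟩ ⟨j, h'⟩ => (key i j x x' y y' h h').1)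
    (fun x _ x' _ y _ y' _ ⟨i, h⟩ ⟨j, h'⟩ => (key i j x x' y y' h h').2)
  refine ⟨f, fun i x y hx hy h => ?_⟩
  obtain ⟨j, hj⟩ := hf ⟨x, hx⟩
  rcases hD.total (f ⟨x, hx⟩).2 hy with h1 | h1
  · rcases h1.lt_or_eq with h1 | h1
    · exact absurd ((key _ _ _ _ _ _ hj h).2 h1) (lt_irrefl _)
    · exact h1
  · rcases h1.lt_or_eq with h1 | h1
    · exact absurd ((key _ _ _ _ _ _ h hj).2 h1) (lt_irrefl _)
    · exact h1.symm

/-- Maximal chains of the interval `[p, q]`. -/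
structure MaxChainIn [PartialOrder α] (p q : α) (C : Set α) : Prop where
  subset : C ⊆ Icc p q
  chain : IsChain (· ≤ ·) C
  maximal : ∀ z ∈ Icc p q, (∀ c ∈ C, z ≤ c ∨ c ≤ z) → z ∈ C

/-- Two sets with isomorphic induced orders. -/
def SameType [LE α] [LE β] (C : Set α) (D : Set β) : Prop := Nonempty (C ≃o D)

namespace SameType

theorem refl [LE α] (C : Set α) : SameType C C := ⟨OrderIso.refl _⟩

theorem symm [LE α] [LE β] {C : Set α} {D : Set β} (h : SameType C D) : SameType D C :=
  h.map OrderIso.symm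

theorem trans {γ : Type*} [LE α] [LE β] [LE γ] {C : Set α} {D : Set β} {E : Set γ}
    (h : SameType C D) (h' : SameType D E) : SameType C E :=
  h.elim fun f => h'.elim fun g => ⟨f.trans g⟩

end SameType

theorem sameType_inter_Icc [PartialOrder α] [PartialOrder β] {C : Set α} {D : Set β}
    (f : C ≃o D) (s t : C) :
    SameType (C ∩ Icc (s : α) t) (D ∩ Icc (f s : β) (f t)) := by
  refine ⟨⟨⟨fun z => ⟨f ⟨z, z.2.1⟩, (f _).2, ?_, ?_⟩, fun z => ⟨f.symm ⟨z, z.2.1⟩, (f.symm _).2, ?_, ?_⟩,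
    ?_, ?_⟩, ?_⟩⟩
  · exact f.monotone (show s ≤ ⟨z, z.2.1⟩ from z.2.2.1)
  · exact f.monotone (show ⟨z, z.2.1⟩ ≤ t from z.2.2.2)
  · exact (f.le_symm_apply).2 (show f s ≤ ⟨z, z.2.1⟩ from z.2.2.1)
  · exact (f.symm_apply_le).2 (show ⟨z, z.2.1⟩ ≤ f t from z.2.2.2)
  · intro z
    ext
    simp
  · intro z
    ext
    simp
  · intro a b
    exact f.le_iff_le (x := ⟨a, a.2.1⟩) (y := ⟨b, b.2.1⟩)

namespace MaxChainIn

variable [PartialOrder α] [PartialOrder β] {p q r : α} {C D : Set α}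

theorem left_mem (h : MaxChainIn p q C) (hpq : p ≤ q) : p ∈ C :=
  h.maximal p ⟨le_rfl, hpq⟩ fun _ hc => Or.inl (h.subset hc).1

theorem right_mem (h : MaxChainIn p q C) (hpq : p ≤ q) : q ∈ C :=
  h.maximal q ⟨hpq, le_rfl⟩ fun _ hc => Or.inr (h.subset hc).2

theorem eq_of_subset (h : MaxChainIn p q C) (hD : IsChain (· ≤ ·) D) (hD' : D ⊆ Icc p q)
    (hCD : C ⊆ D) : D = C :=
  Subset.antisymm (fun z hz => h.maximal z (hD' hz) fun _ hc => hD.total hz (hCD hc)) hCD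

theorem inter_Icc (h : MaxChainIn p q C) {s t : α} (hs : s ∈ C) (ht : t ∈ C) :
    MaxChainIn s t (C ∩ Icc s t) := by
  refine ⟨inter_subset_right, h.chain.mono inter_subset_left, fun z hz hc => ⟨?_, hz⟩⟩
  refine h.maximal z ⟨(h.subset hs).1.trans hz.1, hz.2.trans (h.subset ht).2⟩ fun c hcC => ?_
  rcases h.chain.total hs hcC with h1 | h1
  · rcases h.chain.total hcC ht with h2 | h2
    · exact hc c ⟨hcC, h1, h2⟩
    · exact Or.inl (hz.2.trans h2)
  · exact Or.inr (h1.trans hz.1)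

theorem union (h : MaxChainIn p q C) (h' : MaxChainIn q r D) (hpq : p ≤ q) (hqr : q ≤ r) :
    MaxChainIn p r (C ∪ D) := by
  refine ⟨union_subset (fun z hz => ⟨(h.subset hz).1, (h.subset hz).2.trans hqr⟩)
    (fun z hz => ⟨hpq.trans (h'.subset hz).1, (h'.subset hz).2⟩), ?_, ?_⟩
  · rintro a (ha | ha) b (hb | hb) hab
    · exact h.chain ha hb hab
    · exact Or.inl ((h.subset ha).2.trans (h'.subset hb).1)
    · exact Or.inr ((h.subset hb).2.trans (h'.subset ha).1)
    · exact h'.chain ha hb hab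
  · intro z hz hc
    rcases hc q (Or.inl (h.right_mem hpq)) with h1 | h1
    · exact Or.inl (h.maximal z ⟨hz.1, h1⟩ fun c hcC => hc c (Or.inl hcC))
    · exact Or.inr (h'.maximal z ⟨h1, hz.2⟩ fun c hcC => hc c (Or.inr hcC))

theorem map_right_eq {p' q' : β} {D : Set β} (h : MaxChainIn p q C) (h' : MaxChainIn p' q' D)
    (hpq : p ≤ q) (hpq' : p' ≤ q') (f : C ≃o D) : (f ⟨q, h.right_mem hpq⟩ : β) = q' := by
  refine le_antisymm (h'.subset (f _).2).2 ?_
  have : (⟨q', h'.right_mem hpq'⟩ : D) ≤ f ⟨q, h.right_mem hpq⟩ := by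
    rw [← f.symm_apply_le]
    exact (h.subset (f.symm _).2).2
  exact this

theorem map_left_eq {p' q' : β} {D : Set β} (h : MaxChainIn p q C) (h' : MaxChainIn p' q' D)
    (hpq : p ≤ q) (hpq' : p' ≤ q') (f : C ≃o D) : (f ⟨p, h.left_mem hpq⟩ : β) = p' := by
  refine le_antisymm ?_ (h'.subset (f _).2).1
  have : f ⟨p, h.left_mem hpq⟩ ≤ (⟨p', h'.left_mem hpq'⟩ : D) := by
    rw [← f.le_symm_apply]
    exact (h.subset (f.symm _).2).1
  exact this

theorem sameType_union {p' q' r' : β} {C' D' : Set β}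
    (hC : MaxChainIn p q C) (hD : MaxChainIn q r D)
    (hC' : MaxChainIn p' q' C') (hD' : MaxChainIn q' r' D')
    (hpq : p ≤ q) (hqr : q ≤ r) (hpq' : p' ≤ q') (hqr' : q' ≤ r')
    (h₁ : SameType C C') (h₂ : SameType D D') :
    ∃ f : (C ∪ D : Set α) ≃o (C' ∪ D' : Set β), (f ⟨q, Or.inl (hC.right_mem hpq)⟩ : β) = q' := by
  obtain ⟨f⟩ := h₁
  obtain ⟨g⟩ := h₂
  have hfq := hC.map_right_eq hC' hpq hpq' f
  have hgq := hD.map_left_eq hD' hqr hqr' g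
  have hfq' : ∀ x (hx : x ∈ C), (f ⟨x, hx⟩ : β) = q' → x = q := fun x hx h =>
    congrArg Subtype.val (f.injective (Subtype.ext (h.trans hfq.symm)))
  have hgq' : ∀ x (hx : x ∈ D), (g ⟨x, hx⟩ : β) = q' → x = q := fun x hx h =>
    congrArg Subtype.val (g.injective (Subtype.ext (h.trans hgq.symm)))
  have hU := hC.union hD hpq hqr
  have hU' := hC'.union hD' hpq' hqr'
  obtain ⟨F, hF⟩ := exists_orderIso_of_pieces (ι := Bool) hU.chain hU'.chain
    (fun i x y => cond i (∃ hx : x ∈ D, (g ⟨x, hx⟩ : β) = y) (∃ hx : x ∈ C, (f ⟨x, hx⟩ : β) = y))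
    (by
      rintro x (hx | hx)
      · exact ⟨false, _, Or.inl (f ⟨x, hx⟩).2, hx, rfl⟩
      · exact ⟨true, _, Or.inr (g ⟨x, hx⟩).2, hx, rfl⟩)
    (by
      rintro y (hy | hy)
      · exact ⟨false, _, Or.inl (f.symm ⟨y, hy⟩).2, (f.symm ⟨y, hy⟩).2, by simp⟩
      · exact ⟨true, _, Or.inr (g.symm ⟨y, hy⟩).2, (g.symm ⟨y, hy⟩).2, by simp⟩)
    (by
      rintro (_ | _) x x' _ _ ⟨hx, rfl⟩ ⟨hx', rfl⟩
      · exact (f.lt_iff_lt (x := ⟨x, hx⟩) (y := ⟨x', hx'⟩)).symm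
      · exact (g.lt_iff_lt (x := ⟨x, hx⟩) (y := ⟨x', hx'⟩)).symm)
    (by
      rintro i j x x' y y' hij h h'
      obtain ⟨rfl, rfl⟩ := Bool.lt_iff.1 hij
      obtain ⟨hx, rfl⟩ := h
      obtain ⟨hx', rfl⟩ := h'
      have h1 := (hC.subset hx).2
      have h2 := (hD.subset hx').1
      have h3 := (hC'.subset (f ⟨x, hx⟩).2).2
      have h4 := (hD'.subset (g ⟨x', hx'⟩).2).1
      refine ⟨h1.trans h2, h3.trans h4, fun h => ?_, fun h => ?_⟩
      · obtain rfl : x = q := le_antisymm h1 (h ▸ h2)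
        subst h
        rw [hfq, hgq]
      · rw [hfq' x hx (le_antisymm h3 (h ▸ h4)), hgq' x' hx' (le_antisymm (h ▸ h3) h4)])
  exact ⟨F, hF false q q' _ (Or.inl (hC'.right_mem hpq')) ⟨hC.right_mem hpq, hfq⟩⟩

end MaxChainIn

theorem IsMaxChain.maxChainIn [PartialOrder α] [BoundedOrder α] {C : Set α}
    (h : IsMaxChain (· ≤ ·) C) : MaxChainIn ⊥ ⊤ C := by
  refine ⟨fun z _ => ⟨bot_le, le_top⟩, h.1, fun z _ hc => ?_⟩
  have h1 : IsChain (· ≤ ·) (insert z C) := h.1.insert fun c hcC _ => hc c hcC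
  rw [h.2 h1 (subset_insert _ _)]
  exact mem_insert _ _

theorem MaxChainIn.isMaxChain [PartialOrder α] [BoundedOrder α] {C : Set α}
    (h : MaxChainIn ⊥ ⊤ C) : IsMaxChain (· ≤ ·) C :=
  ⟨h.chain, fun _ ht hCt => (h.eq_of_subset ht (fun _ _ => ⟨bot_le, le_top⟩) hCt).symm⟩

theorem exists_maxChainIn_of_isChain [PartialOrder α] [BoundedOrder α] {c : Set α}
    (hc : IsChain (· ≤ ·) c) : ∃ C, MaxChainIn ⊥ ⊤ C ∧ c ⊆ C :=
  let ⟨M, hM, h⟩ := hc.exists_maxChain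
  ⟨M, hM.maxChainIn, h⟩

theorem exists_maxChainIn [PartialOrder α] [BoundedOrder α] {p q : α} (hpq : p ≤ q) :
    ∃ C, MaxChainIn p q C := by
  obtain ⟨C, hC, h⟩ := exists_maxChainIn_of_isChain (IsChain.pair hpq)
  exact ⟨_, hC.inter_Icc (h (mem_insert _ _)) (h (mem_insert_of_mem _ rfl))⟩

namespace MaxChainIn

variable {B : Type*}

/-- Both intervals are copies of the relative algebra below `q \ p`, and `z ↦ z \ p ⊔ p'` shifts one
onto the other. -/
theorem exists_translate [BooleanAlgebra B] {p q p' q' : B} {C : Set B} (h : MaxChainIn p q C)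
    (hpq : p ≤ q) (hpq' : p' ≤ q') (he : q \ p = q' \ p') :
    ∃ C', MaxChainIn p' q' C' ∧ SameType C C' := by
  have key : ∀ {p q p' q' : B}, p ≤ q → p' ≤ q' → q \ p = q' \ p' → ∀ z ∈ Icc p q,
      (z \ p ⊔ p' ∈ Icc p' q') ∧ (z \ p ⊔ p') \ p' ⊔ p = z := by
    intro p q p' q' hpq hpq' he z hz
    have h1 : z \ p ≤ q' \ p' := he ▸ sdiff_le_sdiff_right hz.2
    refine ⟨⟨le_sup_right, sup_le (h1.trans sdiff_le) hpq'⟩, ?_⟩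
    have h2 : Disjoint (z \ p) p' := disjoint_sdiff_self_left.mono_left h1
    rw [sup_sdiff_right_self, h2.sdiff_eq_left, sdiff_sup_cancel hz.1]
  have mono : ∀ {p p' z w : B}, z ≤ w → z \ p ⊔ p' ≤ w \ p ⊔ p' := fun h =>
    sup_le_sup_right (sdiff_le_sdiff_right h) _
  refine ⟨(fun z => z \ p ⊔ p') '' C, ⟨?_, ?_, ?_⟩, ?_⟩
  · rintro _ ⟨z, hz, rfl⟩
    exact (key hpq hpq' he z (h.subset hz)).1
  · rintro _ ⟨z, hz, rfl⟩ _ ⟨w, hw, rfl⟩ _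
    exact (h.chain.total hz hw).imp mono mono
  · intro z hz hc
    obtain ⟨h1, h2⟩ := key hpq' hpq he.symm z hz
    refine ⟨z \ p' ⊔ p, h.maximal _ h1 fun c hcC => ?_, h2⟩
    have h3 := (key hpq hpq' he c (h.subset hcC)).2
    refine (hc _ ⟨c, hcC, rfl⟩).imp (fun h => ?_) (fun h => ?_)
    · have := mono (p := p') (p' := p) h
      rwa [h3] at this
    · have := mono (p := p') (p' := p) h
      rwa [h3] at this
  · refine ⟨⟨⟨fun z => ⟨z \ p ⊔ p', z, z.2, rfl⟩, fun w => ⟨w \ p' ⊔ p, ?_⟩, ?_, ?_⟩, ?_⟩⟩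
    · obtain ⟨_, z, hz, rfl⟩ := w
      have h3 := (key hpq hpq' he z (h.subset hz)).2
      simp only [h3]
      exact hz
    · intro z
      exact Subtype.ext (key hpq hpq' he z (h.subset z.2)).2
    · rintro ⟨_, z, hz, rfl⟩
      have h3 := (key hpq hpq' he z (h.subset hz)).2
      simp only [h3]
    · intro z w
      refine ⟨fun hzw => ?_, fun hzw => mono hzw⟩
      have := mono (p := p') (p' := p) (show (z : B) \ p ⊔ p' ≤ (w : B) \ p ⊔ p' from hzw)
      rwa [(key hpq hpq' he z (h.subset z.2)).2, (key hpq hpq' he w (h.subset w.2)).2] at this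

section Complete

variable [CompleteLattice B] {p q : B} {C : Set B}

theorem sSup_mem (h : MaxChainIn p q C) {S : Set B} (hS : S ⊆ C) (hne : S.Nonempty) :
    sSup S ∈ C := by
  obtain ⟨s, hs⟩ := hne
  refine h.maximal _ ⟨(h.subset (hS hs)).1.trans (le_sSup hs),
    sSup_le fun t ht => (h.subset (hS ht)).2⟩ fun c hc => ?_
  by_cases hcS : ∃ t ∈ S, c ≤ t
  · obtain ⟨t, ht, hct⟩ := hcS
    exact Or.inr (hct.trans (le_sSup ht))
  · push Not at hcS
    exact Or.inl (sSup_le fun t ht => (h.chain.total (hS ht) hc).resolve_right (hcS t ht))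

theorem sInf_mem (h : MaxChainIn p q C) {S : Set B} (hS : S ⊆ C) (hne : S.Nonempty) :
    sInf S ∈ C := by
  obtain ⟨s, hs⟩ := hne
  refine h.maximal _ ⟨le_sInf fun t ht => (h.subset (hS ht)).1,
    (sInf_le hs).trans (h.subset (hS hs)).2⟩ fun c hc => ?_
  by_cases hcS : ∃ t ∈ S, t ≤ c
  · obtain ⟨t, ht, hct⟩ := hcS
    exact Or.inl ((sInf_le ht).trans hct)
  · push Not at hcS
    exact Or.inr (le_sInf fun t ht => (h.chain.total hc (hS ht)).resolve_right (hcS t ht))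

/-- Maximality holds because an element comparable with everything either dominates all `d k`, hence
is their supremum, or is caught between two consecutive ones. -/
theorem exists_of_seq {d : ℕ → B} (hd : Monotone d) {C : ℕ → Set B}
    (hC : ∀ k, MaxChainIn (d k) (d (k + 1)) (C k)) :
    ∃ D, MaxChainIn (d 0) (⨆ k, d k) D ∧ ∀ k, d k ∈ D ∧ D ∩ Icc (d k) (d (k + 1)) = C k := by
  have hd1 : ∀ k, d k ≤ d (k + 1) := fun k => hd k.le_succ
  have hsub : ∀ k, C k ⊆ insert (⨆ k, d k) (⋃ k, C k) := fun k z hz =>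
    Or.inr (mem_iUnion.2 ⟨k, hz⟩)
  have hIcc : insert (⨆ k, d k) (⋃ k, C k) ⊆ Icc (d 0) (⨆ k, d k) := by
    rintro z (rfl | hz)
    · exact ⟨le_iSup d 0, le_rfl⟩
    · obtain ⟨k, hk⟩ := mem_iUnion.1 hz
      exact ⟨(hd k.zero_le).trans ((hC k).subset hk).1,
        ((hC k).subset hk).2.trans (le_iSup d (k + 1))⟩
  have hchain : IsChain (· ≤ ·) (insert (⨆ k, d k) (⋃ k, C k)) := by
    have hlt : ∀ {j k a b}, j < k → a ∈ C j → b ∈ C k → a ≤ b := fun hjk ha hb =>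
      ((hC _).subset ha).2.trans ((hd hjk).trans ((hC _).subset hb).1)
    refine IsChain.insert ?_ fun b hb _ => Or.inr (hIcc (Or.inr hb)).2
    intro a ha b hb hab
    obtain ⟨j, hj⟩ := mem_iUnion.1 ha
    obtain ⟨k, hk⟩ := mem_iUnion.1 hb
    rcases lt_trichotomy j k with h | rfl | h
    · exact Or.inl (hlt h hj hk)
    · exact (hC _).chain hj hk hab
    · exact Or.inr (hlt h hk hj)
  refine ⟨insert (⨆ k, d k) (⋃ k, C k), ⟨hIcc, hchain, ?_⟩, fun k =>
    ⟨hsub k ((hC k).left_mem (hd1 k)), ?_⟩⟩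
  · intro z hz hc
    by_cases hall : ∀ k, d k ≤ z
    · exact Or.inl (le_antisymm hz.2 (iSup_le hall))
    · push Not at hall
      classical
      obtain ⟨k, hk, hmin⟩ : ∃ k, ¬ d k ≤ z ∧ ∀ j < k, d j ≤ z :=
        ⟨Nat.find hall, Nat.find_spec hall, fun j hj => not_not.1 (Nat.find_min hall hj)⟩
      obtain _ | k := k
      · exact absurd hz.1 hk
      · have hzk : z ≤ d (k + 1) :=
          (hc _ (hsub k ((hC k).right_mem (hd1 k)))).resolve_right hk
        exact hsub k ((hC k).maximal z ⟨hmin k k.lt_succ_self, hzk⟩ fun c hcC => hc c (hsub k hcC))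
  · exact (hC k).eq_of_subset (hchain.mono inter_subset_left) inter_subset_right
      fun z hz => ⟨hsub k hz, (hC k).subset hz⟩

theorem exists_mem_piece {d : ℕ → B} {D : Set B} (hD : MaxChainIn (d 0) (⨆ k, d k) D)
    (hmem : ∀ k, d k ∈ D) {x : B} (hx : x ∈ D) (hne : x ≠ ⨆ k, d k) :
    ∃ k, x ∈ D ∩ Icc (d k) (d (k + 1)) := by
  have hall : ∃ k, ¬ d k ≤ x := by
    by_contra! hcon
    exact hne (le_antisymm (hD.subset hx).2 (iSup_le hcon))
  classical
  obtain ⟨k, hk, hmin⟩ : ∃ k, ¬ d k ≤ x ∧ ∀ j < k, d j ≤ x :=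
    ⟨Nat.find hall, Nat.find_spec hall, fun j hj => not_not.1 (Nat.find_min hall hj)⟩
  obtain _ | k := k
  · exact absurd (hD.subset hx).1 hk
  · exact ⟨k, hx, hmin k k.lt_succ_self, (hD.chain.total hx (hmem _)).resolve_right hk⟩

theorem sameType_of_seq {B' : Type*} [CompleteLattice B'] {d : ℕ → B} {d' : ℕ → B'}
    {D : Set B} {D' : Set B'} (hd : StrictMono d) (hd' : StrictMono d')
    (hD : MaxChainIn (d 0) (⨆ k, d k) D) (hD' : MaxChainIn (d' 0) (⨆ k, d' k) D')
    (hmem : ∀ k, d k ∈ D) (hmem' : ∀ k, d' k ∈ D')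
    (h : ∀ k, SameType (D ∩ Icc (d k) (d (k + 1))) (D' ∩ Icc (d' k) (d' (k + 1)))) :
    SameType D D' := by
  have hlt : ∀ k, d k < ⨆ k, d k := fun k => (hd k.lt_succ_self).trans_le (le_iSup d _)
  have hlt' : ∀ k, d' k < ⨆ k, d' k := fun k => (hd' k.lt_succ_self).trans_le (le_iSup d' _)
  have hC : ∀ k, MaxChainIn (d k) (d (k + 1)) (D ∩ Icc (d k) (d (k + 1))) := fun k =>
    hD.inter_Icc (hmem k) (hmem (k + 1))
  have hC' : ∀ k, MaxChainIn (d' k) (d' (k + 1)) (D' ∩ Icc (d' k) (d' (k + 1))) := fun k =>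
    hD'.inter_Icc (hmem' k) (hmem' (k + 1))
  have hd1 : ∀ k, d k ≤ d (k + 1) := fun k => hd.monotone k.le_succ
  have hd1' : ∀ k, d' k ≤ d' (k + 1) := fun k => hd'.monotone k.le_succ
  have f := fun k => (h k).some
  have hfl := fun k => (hC k).map_left_eq (hC' k) (hd1 k) (hd1' k) (f k)
  have hfr := fun k => (hC k).map_right_eq (hC' k) (hd1 k) (hd1' k) (f k)
  -- The index `⊤` is a piece of its own for the suprema, which lie in no interval between
  -- consecutive terms.
  obtain ⟨F, -⟩ := exists_orderIso_of_pieces (ι := WithTop ℕ) hD.chain hD'.chain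
    (fun i x y => (i = ⊤ ∧ x = ⨆ k, d k ∧ y = ⨆ k, d' k) ∨
      ∃ k : ℕ, i = k ∧ ∃ hx : x ∈ D ∩ Icc (d k) (d (k + 1)), (f k ⟨x, hx⟩ : B') = y)
    (by
      intro x hx
      by_cases h : x = ⨆ k, d k
      · exact ⟨⊤, _, hD'.right_mem (le_iSup d' 0), Or.inl ⟨rfl, h, rfl⟩⟩
      · obtain ⟨k, hk⟩ := hD.exists_mem_piece hmem hx h
        exact ⟨k, _, (f k ⟨x, hk⟩).2.1, Or.inr ⟨k, rfl, hk, rfl⟩⟩)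
    (by
      intro y hy
      by_cases h : y = ⨆ k, d' k
      · exact ⟨⊤, _, hD.right_mem (le_iSup d 0), Or.inl ⟨rfl, rfl, h⟩⟩
      · obtain ⟨k, hk⟩ := hD'.exists_mem_piece hmem' hy h
        exact ⟨k, _, ((f k).symm ⟨y, hk⟩).2.1, Or.inr ⟨k, rfl, ((f k).symm ⟨y, hk⟩).2, by simp⟩⟩)
    (by
      rintro i x x' y y' (⟨rfl, rfl, rfl⟩ | ⟨k, rfl, hx, rfl⟩)
        (⟨h, rfl, rfl⟩ | ⟨k', h, hx', rfl⟩)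
      · simp
      · exact absurd h (WithTop.coe_ne_top).symm
      · exact absurd h WithTop.coe_ne_top
      · obtain rfl := WithTop.coe_injective h
        exact ((f k).lt_iff_lt (x := ⟨x, hx⟩) (y := ⟨x', hx'⟩)).symm)
    (by
      rintro i j x x' y y' hij (⟨rfl, rfl, rfl⟩ | ⟨k, rfl, hx, rfl⟩)
        (⟨rfl, rfl, rfl⟩ | ⟨k', rfl, hx', rfl⟩)
      · exact absurd hij (lt_irrefl _)
      · exact absurd hij not_top_lt
      · have h1 := hx.2.2.trans_lt (hlt _)
        have h2 := (f k ⟨x, hx⟩).2.2.2.trans_lt (hlt' _)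
        exact ⟨h1.le, h2.le, iff_of_false h1.ne h2.ne⟩
      · have hkk : k + 1 ≤ k' := WithTop.coe_lt_coe.1 hij
        have h1 := hx.2.2
        have h2 := hx'.2.1
        have h3 := (f k ⟨x, hx⟩).2.2.2
        have h4 := (f k' ⟨x', hx'⟩).2.2.1
        have h5 := hd.monotone hkk
        have h6 := hd'.monotone hkk
        refine ⟨h1.trans (h5.trans h2), h3.trans (h6.trans h4), fun h => ?_, fun h => ?_⟩
        -- Members of different pieces coincide only at the end point shared by two adjacent pieces.
        · have e1 : x = d (k + 1) := le_antisymm h1 (h ▸ h5.trans h2)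
          have e2 : x' = d k' := le_antisymm (h ▸ h1.trans h5) h2
          obtain rfl : k + 1 = k' := hd.injective (e1 ▸ e2 ▸ h)
          subst e1 e2
          rw [hfr, hfl]
        · have e1 : (f k ⟨x, hx⟩ : B') = d' (k + 1) := le_antisymm h3 (h ▸ h6.trans h4)
          have e2 : (f k' ⟨x', hx'⟩ : B') = d' k' := le_antisymm (h ▸ h3.trans h6) h4
          obtain rfl : k + 1 = k' := hd'.injective (e1 ▸ e2 ▸ h)
          have e3 : x = d (k + 1) := congrArg Subtype.val
            ((f k).injective (Subtype.ext (e1.trans (hfr k).symm)))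
          have e4 : x' = d (k + 1) := congrArg Subtype.val
            ((f (k + 1)).injective (Subtype.ext (e2.trans (hfl (k + 1)).symm)))
          rw [e3, e4])
  exact ⟨F⟩

end Complete

end MaxChainIn

end Chains

/-! ### Distributivity as simultaneous decision, and countable partitions. -/

section Decides

open Set

variable {B : Type u} [CompleteBooleanAlgebra B]

/-- `d` decides `b` if it lies below `b` or below its complement. -/
def Decides (d b : B) : Prop := d ≤ b ∨ Disjoint d b

namespace Decides

variable {d d' b c : B}

theorem mono (h : Decides d b) (hd : d' ≤ d) : Decides d' b :=
  h.imp hd.trans fun h => h.mono_left hd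

theorem compl (h : Decides d b) : Decides d bᶜ :=
  h.symm.imp (fun h => h.le_compl_right) fun h => disjoint_compl_right.mono_left h

theorem of_compl (h : Decides d bᶜ) : Decides d b := by simpa using h.compl

theorem sSup {S : Set B} (h : ∀ s ∈ S, Decides d s) : Decides d (sSup S) := by
  by_cases hS : ∃ s ∈ S, d ≤ s
  · obtain ⟨s, hs, hds⟩ := hS
    exact Or.inl (hds.trans (le_sSup hs))
  · push Not at hS
    exact Or.inr (disjoint_sSup_iff.2 fun s hs => (h s hs).resolve_left (hS s hs))

theorem iSup {ι : Sort*} {f : ι → B} (h : ∀ i, Decides d (f i)) : Decides d (⨆ i, f i) :=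
  sSup (by rintro _ ⟨i, rfl⟩; exact h i)

theorem iInf {ι : Sort*} {f : ι → B} (h : ∀ i, Decides d (f i)) : Decides d (⨅ i, f i) := by
  refine of_compl ?_
  rw [compl_iInf]
  exact iSup fun i => (h i).compl

theorem inf (h : Decides d b) (h' : Decides d c) : Decides d (b ⊓ c) := by
  rcases h with h | h
  · rcases h' with h' | h'
    · exact Or.inl (le_inf h h')
    · exact Or.inr (h'.mono_right inf_le_right)
  · exact Or.inr (h.mono_right inf_le_left)

theorem sdiff (h : Decides d b) (h' : Decides d c) : Decides d (b \ c) := by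
  rw [_root_.sdiff_eq]
  exact h.inf h'.compl

end Decides

/-- Distribute the meet of all `s ⊔ sᶜ`, which is `⊤`: some choice of one side for every `s` has a
meet that is compatible with `b`. -/
theorem AlephZeroDistributive.exists_decides (hB : AlephZeroDistributive B) {S : Set B}
    (hS : S.Countable) {b : B} (hb : b ≠ ⊥) :
    ∃ d, d ≠ ⊥ ∧ d ≤ b ∧ ∀ s ∈ S, Decides d s := by
  rcases S.eq_empty_or_nonempty with rfl | hne
  · exact ⟨b, hb, le_rfl, by simp⟩
  obtain ⟨s, rfl⟩ := hS.exists_eq_range hne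
  let a : ℕ → ULift.{u} Bool → B := fun n j => cond j.down (s n) (s n)ᶜ
  have h := hB (ULift Bool) a
  have htop : ⨅ i, ⨆ j, a i j = ⊤ := by
    refine iInf_eq_top.2 fun i => top_le_iff.1 ?_
    rw [← sup_compl_eq_top (x := s i)]
    exact sup_le (le_iSup (a i) ⟨true⟩) (le_iSup (a i) ⟨false⟩)
  rw [htop] at h
  have hb' : ∃ f : ℕ → ULift Bool, b ⊓ ⨅ i, a i (f i) ≠ ⊥ := by
    by_contra! hcon
    apply hb
    rw [← inf_top_eq b, h, inf_iSup_eq, iSup_eq_bot]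
    exact hcon
  obtain ⟨f, hf⟩ := hb'
  refine ⟨_, hf, inf_le_left, ?_⟩
  rintro _ ⟨n, rfl⟩
  have hn : b ⊓ ⨅ i, a i (f i) ≤ a n (f n) := inf_le_right.trans (iInf_le _ n)
  rcases hfn : (f n).down with _ | _
  · simp only [a, hfn, cond_false] at hn
    exact Or.inr (disjoint_compl_left.mono_left hn)
  · simp only [a, hfn, cond_true] at hn
    exact Or.inl hn

theorem Atomless.exists_lt (hB : Atomless B) {b : B} (hb : b ≠ ⊥) : ∃ c, c ≠ ⊥ ∧ c < b := by
  by_contra! h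
  exact hB b ⟨hb, fun c hc => by_contra fun hne => h c hne hc⟩

theorem exists_maximal_antichain (Q : B → Prop) :
    ∃ W : Set B, (∀ w ∈ W, Q w) ∧ W.PairwiseDisjoint id ∧
      ∀ w, Q w → Disjoint w (sSup W) → w = ⊥ := by
  obtain ⟨W, hW⟩ := zorn_subset {W : Set B | (∀ w ∈ W, Q w) ∧ W.PairwiseDisjoint id} <| by
    intro c hc hchain
    refine ⟨⋃₀ c, ⟨?_, ?_⟩, fun s hs => subset_sUnion_of_mem hs⟩
    · rintro w ⟨s, hs, hws⟩
      exact (hc hs).1 w hws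
    · exact (pairwiseDisjoint_sUnion hchain.directedOn).2 fun s hs => (hc hs).2
  refine ⟨W, hW.prop.1, hW.prop.2, fun w hw hdis => ?_⟩
  have hdisj : ∀ w' ∈ W, Disjoint w w' := fun w' hw' => hdis.mono_right (le_sSup hw')
  have hmem : w ∈ W := hW.le_of_ge (y := insert w W)
    ⟨by rintro z (rfl | hz); exacts [hw, hW.prop.1 z hz],
      hW.prop.2.insert fun w' hw' _ => hdisj w' hw'⟩ (subset_insert _ _) (mem_insert _ _)
  exact disjoint_self.1 (hdisj w hmem)

/-- A maximal antichain among the elements lying below members of `S` is countable and has the same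
join as `S`. -/
theorem CountableChainCondition.exists_countable_sSup_eq (hB : CountableChainCondition B)
    (S : Set B) : ∃ T ⊆ S, T.Countable ∧ sSup T = sSup S := by
  obtain ⟨W, hWS, hWd, hW⟩ := exists_maximal_antichain fun w : B => ∃ s ∈ S, w ≤ s
  choose! g hgS hg using hWS
  refine ⟨g '' W, by rintro _ ⟨w, hw, rfl⟩; exact hgS w hw, (hB W hWd).image g,
    le_antisymm (sSup_le_sSup (by rintro _ ⟨w, hw, rfl⟩; exact hgS w hw)) ?_⟩
  refine sSup_le fun s hs => ?_
  have h1 : s ≤ sSup W := sdiff_eq_bot_iff.1 (hW _ ⟨s, hs, sdiff_le⟩ disjoint_sdiff_self_left)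
  exact h1.trans (sSup_le fun w hw => (hg w hw).trans (le_sSup ⟨w, hw, rfl⟩))

/-- Every nonzero element of a Souslin algebra is the supremum of a strictly increasing sequence
whose successive differences belong to a given dense set. -/
theorem IsSouslinAlgebra.exists_partition (hB : IsSouslinAlgebra B) {P : B → Prop}
    (hP : ∀ b ≠ ⊥, ∃ c ≤ b, c ≠ ⊥ ∧ P c) {b : B} (hb : b ≠ ⊥) :
    ∃ d : ℕ → B, d 0 = ⊥ ∧ StrictMono d ∧ ⨆ k, d k = b ∧ ∀ k, P (d (k + 1) \ d k) := by
  -- The disjoint differences `v n` of a descending sequence serve only to make the partition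
  -- infinite: its members decide every `v n`, so each `v n` contains one of them.
  obtain ⟨u, hu, hu0⟩ : ∃ u : ℕ → {c : B // c ≠ ⊥}, StrictAnti u ∧ u 0 = ⟨b, hb⟩ := by
    have : NoMinOrder {c : B // c ≠ ⊥} := ⟨fun c => by
      obtain ⟨e, he, hlt⟩ := hB.atomless.exists_lt c.2
      exact ⟨⟨e, he⟩, hlt⟩⟩
    exact Nat.exists_strictAnti' _
  let v : ℕ → B := fun n => (u n : B) \ u (n + 1)
  have hvne : ∀ n, v n ≠ ⊥ := fun n h =>
    (show (u (n + 1) : B) < u n from hu n.lt_succ_self).not_ge (sdiff_eq_bot_iff.1 h)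
  have hvle : ∀ n, v n ≤ b := fun n => sdiff_le.trans <| by
    have : u n ≤ u 0 := hu.antitone n.zero_le
    rw [hu0] at this
    exact this
  have hvdisj : ∀ m n, m < n → Disjoint (v m) (v n) := fun m n hmn =>
    disjoint_sdiff_self_left.mono_right (sdiff_le.trans (hu.antitone (Nat.succ_le_of_lt hmn)))
  let Q : B → Prop := fun w => w ≠ ⊥ ∧ w ≤ b ∧ P w ∧ ∀ n, Decides w (v n)
  have hQ : ∀ c ≤ b, c ≠ ⊥ → ∃ w ≤ c, Q w := fun c hcb hc => by
    obtain ⟨e, he, hec, hd⟩ := hB.distributive.exists_decides (countable_range v) hc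
    obtain ⟨w, hwe, hw, hPw⟩ := hP e he
    exact ⟨w, hwe.trans hec, hw, hwe.trans (hec.trans hcb), hPw,
      fun n => (hd _ ⟨n, rfl⟩).mono hwe⟩
  obtain ⟨W, hWQ, hWd, hW⟩ := exists_maximal_antichain Q
  have hsup : sSup W = b := by
    refine le_antisymm (sSup_le fun w hw => (hWQ w hw).2.1) ?_
    by_contra hcon
    obtain ⟨w, hwle, hw⟩ := hQ (b \ sSup W) sdiff_le (fun h => hcon (sdiff_eq_bot_iff.1 h))
    exact hw.1 (hW w hw (disjoint_sdiff_self_left.mono_left hwle))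
  have hmeet : ∀ n, ∃ w ∈ W, w ≤ v n := fun n => by
    by_contra! hcon
    refine hvne n (disjoint_self.1 (((disjoint_sSup_iff (a := v n) (s := W)).2 fun w hw => ?_).mono_right
      (hsup ▸ hvle n)))
    exact (((hWQ w hw).2.2.2 n).resolve_left (hcon w hw)).symm
  choose g hgW hgv using hmeet
  have hinf : W.Infinite := by
    refine infinite_of_injective_forall_mem (f := g) ?_ hgW
    intro m n hmn
    by_contra hne
    have hdis : Disjoint (v m) (v n) := by
      rcases Nat.lt_or_gt_of_ne hne with h | h
      · exact hvdisj _ _ h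
      · exact (hvdisj _ _ h).symm
    exact (hWQ _ (hgW m)).1 (disjoint_self.1 (hdis.mono (hgv m) (hmn ▸ hgv n)))
  obtain ⟨hden⟩ := countable_infinite_iff_nonempty_denumerable.1 ⟨hB.ccc W hWd, hinf⟩
  let w : ℕ → W := (Denumerable.eqv W).symm
  have hwdisj : ∀ m n, m ≠ n → Disjoint (w m : B) (w n) := fun m n hmn =>
    hWd (w m).2 (w n).2 fun h => hmn ((Denumerable.eqv W).symm.injective (Subtype.ext h))
  let d : ℕ → B := fun k => (Finset.range k).sup fun i => (w i : B)
  have hd : ∀ k, d (k + 1) = (w k : B) ⊔ d k := fun k => by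
    simp only [d, Finset.range_add_one, Finset.sup_insert]
  have hdw : ∀ k, d (k + 1) \ d k = w k := fun k => by
    have : Disjoint (w k : B) (d k) := by
      refine Finset.disjoint_sup_right.2 fun i hi => hwdisj _ _ ?_
      exact (Finset.mem_range.1 hi).ne'
    rw [hd, sup_sdiff_right_self, this.sdiff_eq_left]
  refine ⟨d, by simp [d], strictMono_nat_of_lt_succ fun k => ?_, ?_, fun k => ?_⟩
  · refine lt_of_le_not_ge (hd k ▸ le_sup_right) fun h => ?_
    have := hdw k
    rw [sdiff_eq_bot_iff.2 h] at this
    exact (hWQ _ (w k).2).1 this.symm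
  · refine le_antisymm (iSup_le fun k => Finset.sup_le fun i _ => (hWQ _ (w i).2).2.1) ?_
    rw [← hsup]
    refine sSup_le fun z hz => ?_
    obtain ⟨k, hk⟩ := (Denumerable.eqv W).symm.surjective ⟨z, hz⟩
    have : (w k : B) = z := congrArg Subtype.val hk
    rw [← this]
    exact (hdw k ▸ sdiff_le : (w k : B) ≤ d (k + 1)).trans (le_iSup d (k + 1))
  · rw [hdw]
    exact (hWQ _ (w k).2).2.2.1

/-- No countable part of a maximal chain is order dense in it: a nonzero `d` deciding all of `F`
sits between the join of the members disjoint from `d` and the meet of those above `d`. -/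
theorem MaxChainIn.exists_gap [Nontrivial B] (hB : AlephZeroDistributive B) {K : Set B}
    (hK : MaxChainIn ⊥ ⊤ K) {F : Set B} (hF : F ⊆ K) (hFc : F.Countable) :
    ∃ p ∈ K, ∃ q ∈ K, p < q ∧ ∀ e ∈ F, e ≤ p ∨ q ≤ e := by
  obtain ⟨d, hd, -, hdF⟩ := hB.exists_decides hFc (top_ne_bot (α := B))
  have hp : sSup (insert ⊥ {e ∈ F | Disjoint d e}) ∈ K :=
    hK.sSup_mem (insert_subset (hK.left_mem bot_le) fun e he => hF he.1) (insert_nonempty _ _)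
  have hq : sInf (insert ⊤ {e ∈ F | d ≤ e}) ∈ K :=
    hK.sInf_mem (insert_subset (hK.right_mem bot_le) fun e he => hF he.1) (insert_nonempty _ _)
  have hdp : Disjoint d (sSup (insert ⊥ {e ∈ F | Disjoint d e})) := by
    refine disjoint_sSup_iff.2 ?_
    rintro e (rfl | he)
    exacts [disjoint_bot_right, he.2]
  have hdq : d ≤ sInf (insert ⊤ {e ∈ F | d ≤ e}) := by
    refine le_sInf ?_
    rintro e (rfl | he)
    exacts [le_top, he.2]
  refine ⟨_, hp, _, hq, ?_, fun e he => ?_⟩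
  · have h : ¬ sInf (insert ⊤ {e ∈ F | d ≤ e}) ≤ sSup (insert ⊥ {e ∈ F | Disjoint d e}) :=
      fun h => hd (disjoint_self.1 (hdp.mono_right (hdq.trans h)))
    exact lt_of_le_not_ge ((hK.chain.total hp hq).resolve_right h) h
  · rcases hdF e he with h | h
    · exact Or.inr (sInf_le (Or.inr ⟨he, h⟩))
    · exact Or.inl (le_sSup (Or.inr ⟨he, h⟩))

end Decides

/-! ### From chain homogeneity to homogeneity of all intervals. -/

section Homogeneity

open Set

variable {B : Type u} [CompleteBooleanAlgebra B]

theorem ChainHomogeneous.sameType (h : ChainHomogeneous B) {C D : Set B}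
    (hC : MaxChainIn ⊥ ⊤ C) (hD : MaxChainIn ⊥ ⊤ D) : SameType C D :=
  h C D hC.isMaxChain hD.isMaxChain

/-- Final segments of a maximal chain `K`, starting from the members of a sequence converging
to `⊤`, occur as final segments of any maximal chain of any interval. -/
theorem ChainHomogeneous.exists_tail (h : ChainHomogeneous B) {K : Set B}
    (hK : MaxChainIn ⊥ ⊤ K) {e : ℕ → B} (he : StrictMono e) (heK : ∀ n, e n ∈ K)
    (hsup : ⨆ n, e n = ⊤) {p q : B} (hpq : p < q) {X : Set B} (hX : MaxChainIn p q X) :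
    ∃ N, ∀ n ≥ N, ∃ r ∈ X, r < q ∧ SameType (X ∩ Icc r q) (K ∩ Icc (e n) ⊤) := by
  -- Pushed up against `⊤` and completed below, `X` becomes the upper end of a maximal chain of `B`,
  -- which is isomorphic to `K`. The image of its lower end is below `⊤`, so the sequence `e` passes
  -- it.
  obtain ⟨X', hX', ⟨g⟩⟩ := hX.exists_translate hpq.le (le_top : (q \ p)ᶜ ≤ ⊤) (by simp)
  obtain ⟨D, hD⟩ := exists_maxChainIn (bot_le : ⊥ ≤ (q \ p)ᶜ)
  have hZ := hD.union hX' bot_le le_top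
  obtain ⟨f⟩ := h.sameType hZ hK
  have hmX : (q \ p)ᶜ ∈ X' := hX'.left_mem le_top
  let m : (D ∪ X' : Set B) := ⟨(q \ p)ᶜ, Or.inr hmX⟩
  have hmtop : m < ⟨⊤, Or.inr (hX'.right_mem le_top)⟩ := by
    refine lt_of_le_of_ne le_top fun heq => ?_
    have h1 : (q \ p)ᶜ = ⊤ := congrArg Subtype.val heq
    exact hpq.not_ge (sdiff_eq_bot_iff.1 (compl_eq_top.1 h1))
  have hftop := hZ.map_right_eq hK bot_le bot_le f
  have hfm : (f m : B) < ⊤ := by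
    rw [← hftop]
    exact f.lt_iff_lt.2 hmtop
  obtain ⟨N, hN⟩ : ∃ N, ¬ e N ≤ f m := by
    by_contra! hcon
    exact hfm.not_ge (hsup ▸ iSup_le hcon)
  refine ⟨N, fun n hn => ?_⟩
  have hn' : (f m : B) ≤ e n := (hK.chain.total (f m).2 (heK n)).resolve_right
    fun h => hN ((he.monotone hn).trans h)
  let r : (D ∪ X' : Set B) := f.symm ⟨e n, heK n⟩
  have hmr : m ≤ r := f.le_symm_apply.2 hn'
  have hrX : (r : B) ∈ X' := by
    rcases r.2 with hr | hr
    · have : (r : B) = (q \ p)ᶜ := le_antisymm (hD.subset hr).2 hmr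
      rw [this]
      exact hmX
    · exact hr
  have hrt : (r : B) ≠ ⊤ := fun hrt => by
    have h1 : r = ⟨⊤, Or.inr (hX'.right_mem le_top)⟩ := Subtype.ext hrt
    have h2 : f r = ⟨e n, heK n⟩ := f.apply_symm_apply _
    rw [h1] at h2
    have h3 : e n = ⊤ := (congrArg Subtype.val h2).symm.trans hftop
    exact (he n.lt_succ_self).not_ge (h3 ▸ le_top)
  have hgq := hX.map_right_eq hX' hpq.le le_top g
  let s : X := g.symm ⟨r, hrX⟩
  refine ⟨s, s.2, lt_of_le_of_ne (hX.subset s.2).2 fun hsq => hrt ?_, ?_⟩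
  · have h1 : s = ⟨q, hX.right_mem hpq.le⟩ := Subtype.ext hsq
    have h2 : g s = ⟨r, hrX⟩ := g.apply_symm_apply _
    rw [h1] at h2
    exact (congrArg Subtype.val h2).symm.trans hgq
  · have h1 := sameType_inter_Icc g s ⟨q, hX.right_mem hpq.le⟩
    have h2 := sameType_inter_Icc f r ⟨⊤, Or.inr (hX'.right_mem le_top)⟩
    rw [hgq, show g s = ⟨r, hrX⟩ from g.apply_symm_apply _] at h1
    rw [hftop, show f r = ⟨e n, heK n⟩ from f.apply_symm_apply _] at h2
    have h3 : (D ∪ X') ∩ Icc (r : B) ⊤ = X' ∩ Icc (r : B) ⊤ := by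
      refine Subset.antisymm ?_ (inter_subset_inter_left _ subset_union_right)
      rintro z ⟨hz | hz, hrz⟩
      · have hz1 : (q \ p)ᶜ ≤ z := (show (q \ p)ᶜ ≤ (r : B) from hmr).trans hrz.1
        rw [le_antisymm (hD.subset hz).2 hz1] at hrz ⊢
        exact ⟨hmX, hrz⟩
      · exact ⟨hz, hrz⟩
    rw [← h3] at h1
    exact h1.trans h2

theorem MaxChainIn.exists_of_partition {P : Set B → Prop}
    {d : ℕ → B} (hd : StrictMono d)
    (hP : ∀ k, ∃ X, MaxChainIn ⊥ (d (k + 1) \ d k) X ∧ P X) :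
    ∃ D, MaxChainIn (d 0) (⨆ k, d k) D ∧ ∀ k, d k ∈ D ∧
      ∃ X, P X ∧ SameType X (D ∩ Icc (d k) (d (k + 1))) := by
  have h1 : ∀ k, ∃ C, MaxChainIn (d k) (d (k + 1)) C ∧ ∃ X, P X ∧ SameType X C := fun k => by
    obtain ⟨X, hX, hPX⟩ := hP k
    obtain ⟨C, hC, hXC⟩ := hX.exists_translate bot_le (hd.monotone k.le_succ) (by simp)
    exact ⟨C, hC, X, hPX, hXC⟩
  choose C hC hPC using h1
  obtain ⟨D, hD, hDC⟩ := MaxChainIn.exists_of_seq hd.monotone hC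
  refine ⟨D, hD, fun k => ⟨(hDC k).1, ?_⟩⟩
  rw [(hDC k).2]
  exact hPC k

/-- `w` carries a maximal chain of the same type as `I`. -/
def HasChain (I : Set B) (w : B) : Prop := ∃ X, MaxChainIn ⊥ w X ∧ SameType X I

theorem MaxChainIn.hasChain_sdiff {I X : Set B} {p q : B} (hX : MaxChainIn p q X) (hpq : p ≤ q)
    (h : SameType X I) : HasChain I (q \ p) := by
  obtain ⟨X', hX', hs⟩ := hX.exists_translate hpq (bot_le : ⊥ ≤ q \ p) (by simp)
  exact ⟨X', hX', hs.symm.trans h⟩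

/-- Some order type occurs as the type of a maximal chain below densely many elements. -/
theorem IsSouslinAlgebra.exists_dense_type (hB : IsSouslinAlgebra B) (h : ChainHomogeneous B) :
    ∃ I : Set B, ∀ b ≠ ⊥, ∃ c ≤ b, c ≠ ⊥ ∧ HasChain I c := by
  have := hB.nontrivial
  obtain ⟨e, he0, he, hesup, -⟩ := hB.exists_partition (P := fun _ => True)
    (fun b hb => ⟨b, le_rfl, hb, trivial⟩) (top_ne_bot (α := B))
  obtain ⟨K, hK, hKe⟩ := MaxChainIn.exists_of_partition (P := fun _ => True) he fun k =>
    (exists_maxChainIn bot_le).imp fun _ hX => ⟨hX, trivial⟩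
  rw [he0, hesup] at hK
  have heK := fun k => (hKe k).1
  -- For each `n`, some maximal chain is cut into `ω` pieces, each isomorphic to an interval of `K`
  -- above `e n`.
  have step : ∀ n, ∃ d : ℕ → B, ∃ D, d 0 = ⊥ ∧ StrictMono d ∧ ⨆ k, d k = ⊤ ∧ MaxChainIn ⊥ ⊤ D ∧
      ∀ k, d k ∈ D ∧ ∃ s ∈ K, ∃ t ∈ K, e n ≤ s ∧
        SameType (D ∩ Icc (d k) (d (k + 1))) (K ∩ Icc s t) := by
    intro n
    obtain ⟨d, hd0, hd, hdsup, hdP⟩ := hB.exists_partition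
      (P := fun w => ∃ X, MaxChainIn ⊥ w X ∧ ∃ s ∈ K, ∃ t ∈ K, e n ≤ s ∧ SameType X (K ∩ Icc s t))
      (fun b hb => by
        obtain ⟨X, hX⟩ := exists_maxChainIn (bot_le : ⊥ ≤ b)
        obtain ⟨N, hN⟩ := h.exists_tail hK he heK hesup (bot_lt_iff_ne_bot.2 hb) hX
        obtain ⟨r, hr, hrb, hs⟩ := hN (max N n) (le_max_left _ _)
        obtain ⟨X', hX', hs'⟩ := (hX.inter_Icc hr (hX.right_mem bot_le)).hasChain_sdiff hrb.le hs
        exact ⟨b \ r, sdiff_le, fun h0 => hrb.not_ge (sdiff_eq_bot_iff.1 h0), X', hX', _,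
          heK _, ⊤, hK.right_mem bot_le, he.monotone (le_max_right _ _), hs'⟩)
      (top_ne_bot (α := B))
    obtain ⟨D, hD, hDk⟩ := MaxChainIn.exists_of_partition hd hdP
    rw [hd0, hdsup] at hD
    refine ⟨d, D, hd0, hd, hdsup, hD, fun k => ⟨(hDk k).1, ?_⟩⟩
    obtain ⟨X, ⟨s, hs, t, ht, hes, hX⟩, hXD⟩ := (hDk k).2
    exact ⟨s, hs, t, ht, hes, hXD.symm.trans hX⟩
  choose d D hd0 hd hdsup hD hdD using step
  have f := fun n => (h.sameType (hD n) hK).some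
  -- There are countably many cut points over all `n` together, so some gap of `K` avoids all their
  -- images. The corresponding interval of each `D n` lies within a single piece, so the type of `K
  -- ∩ Icc p q` recurs in `K` above every `e n`.
  let F : Set B := range fun nk : ℕ × ℕ => (f nk.1 ⟨d nk.1 nk.2, (hdD nk.1 nk.2).1⟩ : B)
  obtain ⟨p, hp, q, hq, hpq, hgap⟩ := hK.exists_gap hB.distributive
    (F := F) (by rintro _ ⟨nk, rfl⟩; exact (f nk.1 _).2) (countable_range _)
  have hI : ∀ n, ∃ u ∈ K, ∃ v ∈ K, e n ≤ u ∧ u < v ∧ SameType (K ∩ Icc u v) (K ∩ Icc p q) := by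
    intro n
    let dd : ℕ → D n := fun k => ⟨d n k, (hdD n k).1⟩
    have hall : ∃ k, ¬ (f n (dd k) : B) ≤ p := by
      by_contra! hcon
      have h1 : ∀ k, dd k ≤ (f n).symm ⟨p, hp⟩ := fun k => (f n).le_symm_apply.2 (hcon k)
      have h2 : (((f n).symm ⟨p, hp⟩ : D n) : B) = ⊤ := top_le_iff.1 (hdsup n ▸ iSup_le h1)
      have h3 := (hD n).map_right_eq hK bot_le bot_le (f n)
      rw [show (⟨⊤, (hD n).right_mem bot_le⟩ : D n) = (f n).symm ⟨p, hp⟩ from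
        Subtype.ext h2.symm, OrderIso.apply_symm_apply] at h3
      have h4 : p = ⊤ := h3
      exact hpq.not_ge (h4 ▸ le_top)
    classical
    obtain ⟨k, hk, hmin⟩ : ∃ k, ¬ (f n (dd k) : B) ≤ p ∧ ∀ j < k, (f n (dd j) : B) ≤ p :=
      ⟨Nat.find hall, Nat.find_spec hall, fun j hj => not_not.1 (Nat.find_min hall hj)⟩
    obtain _ | k := k
    · refine absurd ?_ hk
      have h3 := (hD n).map_left_eq hK bot_le bot_le (f n)
      rw [show dd 0 = ⟨⊥, (hD n).left_mem bot_le⟩ from Subtype.ext (hd0 n), h3]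
      exact bot_le
    have hkq : q ≤ f n (dd (k + 1)) := (hgap _ ⟨(n, k + 1), rfl⟩).resolve_left hk
    have hkp : (f n (dd k) : B) ≤ p := hmin k k.lt_succ_self
    let p' : D n := (f n).symm ⟨p, hp⟩
    let q' : D n := (f n).symm ⟨q, hq⟩
    have hp' : dd k ≤ p' := (f n).le_symm_apply.2 hkp
    have hq' : q' ≤ dd (k + 1) := (f n).symm_apply_le.2 hkq
    have hpq' : p' < q' := (f n).symm.lt_iff_lt.2 hpq
    obtain ⟨s, hs, t, ht, hes, ⟨g⟩⟩ := (hdD n k).2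
    let p'' : (D n ∩ Icc (d n k) (d n (k + 1)) : Set B) := ⟨p', p'.2, hp', hpq'.le.trans hq'⟩
    let q'' : (D n ∩ Icc (d n k) (d n (k + 1)) : Set B) := ⟨q', q'.2, hp'.trans hpq'.le, hq'⟩
    have h1 := sameType_inter_Icc (f n) p' q'
    rw [show f n p' = ⟨p, hp⟩ from (f n).apply_symm_apply _,
      show f n q' = ⟨q, hq⟩ from (f n).apply_symm_apply _] at h1
    have h2 := sameType_inter_Icc g p'' q''
    have h3 : D n ∩ Icc (d n k) (d n (k + 1)) ∩ Icc (p' : B) q' = D n ∩ Icc (p' : B) q' := by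
      rw [inter_assoc, inter_eq_right.2 (Icc_subset_Icc (show d n k ≤ (p' : B) from hp')
        (show (q' : B) ≤ d n (k + 1) from hq'))]
    have h4 : K ∩ Icc s t ∩ Icc (g p'' : B) (g q'') = K ∩ Icc (g p'' : B) (g q'') := by
      rw [inter_assoc, inter_eq_right.2 (Icc_subset_Icc (g p'').2.2.1 (g q'').2.2.2)]
    rw [h3, h4] at h2
    exact ⟨_, (g p'').2.1, _, (g q'').2.1, hes.trans (g p'').2.2.1,
      g.lt_iff_lt.2 (show p'' < q'' from hpq'), h2.symm.trans h1⟩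
  refine ⟨K ∩ Icc p q, fun b hb => ?_⟩
  -- A tail of `X` is a tail of `K`, which contains an interval of the recurring type.
  obtain ⟨X, hX⟩ := exists_maxChainIn (bot_le : ⊥ ≤ b)
  obtain ⟨N, hN⟩ := h.exists_tail hK he heK hesup (bot_lt_iff_ne_bot.2 hb) hX
  obtain ⟨r, hr, hrb, ⟨g⟩⟩ := hN N le_rfl
  obtain ⟨u, hu, v, hv, heu, huv, hI⟩ := hI N
  let u' := g.symm ⟨u, hu, heu, le_top⟩
  let v' := g.symm ⟨v, hv, heu.trans huv.le, le_top⟩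
  have huv' : u' < v' := g.symm.lt_iff_lt.2 huv
  have h1 := sameType_inter_Icc g u' v'
  rw [show g u' = ⟨u, hu, heu, le_top⟩ from g.apply_symm_apply _,
    show g v' = ⟨v, hv, heu.trans huv.le, le_top⟩ from g.apply_symm_apply _] at h1
  have h3 : X ∩ Icc r b ∩ Icc (u' : B) v' = X ∩ Icc (u' : B) v' := by
    rw [inter_assoc, inter_eq_right.2 (Icc_subset_Icc u'.2.2.1 v'.2.2.2)]
  have h4 : K ∩ Icc (e N) ⊤ ∩ Icc u v = K ∩ Icc u v := by
    rw [inter_assoc, inter_eq_right.2 (Icc_subset_Icc heu le_top)]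
  rw [h3, h4] at h1
  exact ⟨v' \ u', sdiff_le.trans v'.2.2.2, fun h0 => huv'.not_ge (sdiff_eq_bot_iff.1 h0),
    (hX.inter_Icc u'.2.1 v'.2.1).hasChain_sdiff huv'.le (h1.trans hI)⟩

/-- In a chain homogeneous Souslin algebra, all maximal chains of all nontrivial intervals are
isomorphic. -/
theorem IsSouslinAlgebra.sameType_of_maxChainIn (hB : IsSouslinAlgebra B)
    (h : ChainHomogeneous B) {p q p' q' : B} (hpq : p < q) (hpq' : p' < q') {X X' : Set B}
    (hX : MaxChainIn p q X) (hX' : MaxChainIn p' q' X') : SameType X X' := by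
  have := hB.nontrivial
  obtain ⟨I, hI⟩ := hB.exists_dense_type h
  -- The type of `D` does not depend on `b`: it is `ω` copies of `I`, glued at end points and closed
  -- by a top.
  have hω : ∀ b ≠ (⊥ : B), ∃ d : ℕ → B, ∃ D, d 0 = ⊥ ∧ StrictMono d ∧ ⨆ k, d k = b ∧
      MaxChainIn ⊥ b D ∧ ∀ k, d k ∈ D ∧ SameType (D ∩ Icc (d k) (d (k + 1))) I := by
    intro b hb
    obtain ⟨d, hd0, hd, hdsup, hdP⟩ := hB.exists_partition hI hb
    obtain ⟨D, hD, hDk⟩ := MaxChainIn.exists_of_partition hd hdP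
    rw [hd0, hdsup] at hD
    refine ⟨d, D, hd0, hd, hdsup, hD, fun k => ⟨(hDk k).1, ?_⟩⟩
    obtain ⟨X, hX, hXD⟩ := (hDk k).2
    exact hXD.symm.trans hX
  obtain ⟨e, K, he0, he, hesup, hK, heK⟩ := hω ⊤ top_ne_bot
  suffices key : ∀ {p q : B} {X : Set B}, p < q → MaxChainIn p q X → SameType X K from
    (key hpq hX).trans (key hpq' hX').symm
  intro p q X hpq hX
  obtain ⟨N, hN⟩ := h.exists_tail hK he (fun k => (heK k).1) hesup hpq hX
  obtain ⟨r, hr, hrq, hs⟩ := hN N le_rfl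
  have hpr := (hX.subset hr).1
  have hXp := hX.left_mem hpq.le
  have hXq := hX.right_mem hpq.le
  have h1 := hX.inter_Icc hXp hr
  have h2 := hX.inter_Icc hr hXq
  -- The part of `X` below `r` moves to `[⊥, r \ p]`. The part above `r` has the type of a tail of
  -- `K`, again `ω` copies of `I` and a top, so a chain of that type exists over `[r \ p, ⊤]`.
  -- Together they form a maximal chain of `B` of the type of `X`.
  obtain ⟨Y, hY, hXY⟩ := h1.exists_translate hpr (bot_le : ⊥ ≤ r \ p) (by simp)
  have hne : (r \ p)ᶜ ≠ ⊥ := fun h0 => by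
    have h3 : r \ p = ⊤ := compl_eq_bot.1 h0
    have h4 : r = ⊤ := top_le_iff.1 (h3 ▸ sdiff_le)
    exact hrq.not_ge (h4 ▸ le_top)
  obtain ⟨d, D, hd0, hd, hdsup, hD, hdD⟩ := hω _ hne
  obtain ⟨Z, hZ, hDZ⟩ := hD.exists_translate bot_le (le_top : r \ p ≤ ⊤) (by simp)
  have hKN := hK.inter_Icc (heK N).1 (hK.right_mem bot_le)
  have hDK : SameType D (K ∩ Icc (e N) ⊤) := by
    have hsup' : ⨆ k, e (k + N) = ⊤ := by
      rw [← hesup]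
      exact he.monotone.iSup_nat_add N
    refine MaxChainIn.sameType_of_seq (d := d) (d' := fun k => e (k + N)) hd
      (fun a b hab => he (by omega)) (by rwa [hd0, hdsup]) (by rw [hsup', zero_add]; exact hKN)
      (fun k => (hdD k).1) (fun k => ⟨(heK _).1, he.monotone (by omega), le_top⟩) fun k => ?_
    refine (hdD k).2.trans (SameType.trans (heK (k + N)).2.symm ?_)
    rw [inter_assoc, inter_eq_right.2 (Icc_subset_Icc (he.monotone (by omega)) le_top),
      show k + 1 + N = k + N + 1 by omega]
    exact SameType.refl _
  obtain ⟨g, -⟩ := h1.sameType_union h2 hY hZ hpr hrq.le bot_le le_top hXY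
    ((hs.trans hDK.symm).trans hDZ)
  have hXX : X ∩ Icc p r ∪ X ∩ Icc r q = X := by
    refine Subset.antisymm (union_subset inter_subset_left inter_subset_left) fun z hz => ?_
    exact (hX.chain.total hz hr).imp (fun h => ⟨hz, (hX.subset hz).1, h⟩)
      fun h => ⟨hz, h, (hX.subset hz).2⟩
  rw [hXX] at g
  exact SameType.trans ⟨g⟩ (h.sameType (hY.union hZ bot_le le_top) hK)

theorem IsSouslinAlgebra.exists_orderIso_map_eq (hB : IsSouslinAlgebra B)
    (h : ChainHomogeneous B) {K L : Set B} (hK : MaxChainIn ⊥ ⊤ K) (hL : MaxChainIn ⊥ ⊤ L)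
    {x y : B} (hx : x ∈ K) (hy : y ∈ L) (hx₀ : ⊥ < x) (hx₁ : x < ⊤) (hy₀ : ⊥ < y) (hy₁ : y < ⊤) :
    ∃ f : K ≃o L, (f ⟨x, hx⟩ : B) = y := by
  have split : ∀ {K : Set B} {x : B}, MaxChainIn ⊥ ⊤ K → x ∈ K → K ∩ Icc ⊥ x ∪ K ∩ Icc x ⊤ = K := by
    intro K x hK hx
    refine Subset.antisymm (union_subset inter_subset_left inter_subset_left) fun z hz => ?_
    exact (hK.chain.total hz hx).imp (fun h => ⟨hz, bot_le, h⟩) fun h => ⟨hz, h, le_top⟩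
  have h1 := hK.inter_Icc (hK.left_mem bot_le) hx
  have h2 := hK.inter_Icc hx (hK.right_mem bot_le)
  have h3 := hL.inter_Icc (hL.left_mem bot_le) hy
  have h4 := hL.inter_Icc hy (hL.right_mem bot_le)
  obtain ⟨f, hf⟩ := h1.sameType_union h2 h3 h4 bot_le le_top bot_le le_top
    (hB.sameType_of_maxChainIn h hx₀ hy₀ h1 h3) (hB.sameType_of_maxChainIn h hx₁ hy₁ h2 h4)
  exact ⟨(OrderIso.setCongr _ _ (split hK hx).symm).trans
    (f.trans (OrderIso.setCongr _ _ (split hL hy))), hf⟩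

end Homogeneity

/-! ### Enumerations along `ω₁`. -/

section Enumeration

open Set

theorem exists_enumeration {X : Type u} {D : Set X} (hD : #D ≤ Cardinal.aleph 1) (x : X) :
    ∃ y : (Cardinal.aleph.{u} 1).ord.ToType → X, (∀ d ∈ D, ∃ α, y α = d) ∧
      ∃ o, (∀ α, o ≤ α) ∧ y o = x := by
  classical
  let ι := (Cardinal.aleph.{u} 1).ord.ToType
  have hι : #ι = Cardinal.aleph 1 := Cardinal.mk_ord_toType _
  have hne : Nonempty ι := by
    rw [← Cardinal.mk_ne_zero_iff, hι]
    exact (Cardinal.aleph_pos 1).ne'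
  obtain ⟨o, -, ho⟩ := WellFounded.has_min (wellFounded_lt (α := ι)) univ univ_nonempty
  have hle : #(Option D) ≤ #ι := by
    rw [Cardinal.mk_option, hι]
    exact Cardinal.add_le_of_le (Cardinal.aleph0_le_aleph 1) hD
      (Cardinal.one_le_aleph0.trans (Cardinal.aleph0_le_aleph 1))
  obtain ⟨i⟩ := hle
  -- The point `none` stands for `x`; the swap moves its code to the least index.
  let j : Option D → ι := fun w => Equiv.swap o (i none) (i w)
  have hj : Function.Injective j := (Equiv.injective _).comp i.injective
  let g : Option D → X := fun w => w.elim x Subtype.val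
  refine ⟨fun α => g (Function.invFun j α), fun d hd => ⟨j (some ⟨d, hd⟩), ?_⟩, o,
    fun α => not_lt.1 (ho α trivial), ?_⟩
  · simp only [Function.leftInverse_invFun hj _]
    rfl
  · have : j none = o := Equiv.swap_apply_right _ _
    rw [← this]
    simp only [Function.leftInverse_invFun hj _]
    rfl

theorem countable_Iio_toType (α : (Cardinal.aleph.{u} 1).ord.ToType) : (Iio α).Countable := by
  rw [← Cardinal.le_aleph0_iff_set_countable]
  by_contra! h
  have hlt : #(Iio α) < Cardinal.aleph 1 := by simpa using Cardinal.mk_Iio_lt α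
  exact (Cardinal.aleph_one_le_iff.2 h).not_gt hlt

end Enumeration

/-! ### Interval dense chains from lexicographic cuts. -/

section LexicographicCuts

open Set

variable {B : Type u} [CompleteBooleanAlgebra B] {ι : Type u} [LinearOrder ι]

open Classical in
/-- The meet of the elements `y γ`, `γ ∈ ε`, and `(y γ)ᶜ`, `γ ∉ ε`, over all `γ < α`. -/
noncomputable def branch (y : ι → B) (ε : Set ι) (α : ι) : B :=
  ⨅ γ, ⨅ _ : γ < α, if γ ∈ ε then y γ else (y γ)ᶜ

/-- The join of all branches that branch off from `ε` to the `(y β)ᶜ` side at some `β ≤ α`. -/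
noncomputable def lexCut (y : ι → B) (ε : Set ι) (α : ι) : B :=
  ⨆ β, ⨆ _ : β ≤ α ∧ β ∈ ε, branch y ε β ⊓ (y β)ᶜ

variable {y y' : ι → B} {ε ε' : Set ι} {α β γ δ : ι} {d e : B}

theorem branch_congr (hy : ∀ γ < α, y γ = y' γ) (hε : ∀ γ < α, (γ ∈ ε ↔ γ ∈ ε')) :
    branch y ε α = branch y' ε' α := by
  refine iInf_congr fun γ => iInf_congr fun hγ => ?_
  rw [hy γ hγ]
  by_cases h : γ ∈ ε
  · rw [if_pos h, if_pos ((hε γ hγ).1 h)]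
  · rw [if_neg h, if_neg fun h' => h ((hε γ hγ).2 h')]

open Classical in
theorem branch_le_ite (h : γ < α) : branch y ε α ≤ if γ ∈ ε then y γ else (y γ)ᶜ :=
  iInf₂_le (f := fun γ (_ : γ < α) => if γ ∈ ε then y γ else (y γ)ᶜ) γ h

theorem branch_anti (h : α ≤ β) : branch y ε β ≤ branch y ε α :=
  le_iInf₂ fun _ hγ => branch_le_ite (hγ.trans_le h)

theorem branch_le (h : γ < α) (hγ : γ ∈ ε) : branch y ε α ≤ y γ :=
  (branch_le_ite h).trans (by simp [hγ])

theorem branch_le_compl (h : γ < α) (hγ : γ ∉ ε) : branch y ε α ≤ (y γ)ᶜ :=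
  (branch_le_ite h).trans (by simp [hγ])

theorem le_branch_of_decides (hd : ∀ γ < α, Decides d (y γ)) : d ≤ branch y {γ | d ≤ y γ} α := by
  refine le_iInf₂ fun γ hγ => ?_
  by_cases h : d ≤ y γ
  · simp [h]
  · simpa [h] using ((hd γ hγ).resolve_left h).le_compl_right

theorem le_branch_of_le (hd : d ≠ ⊥) (hde : d ≤ e) (he : ∀ γ < α, Decides e (y γ)) :
    e ≤ branch y {γ | d ≤ y γ} α := by
  refine (le_branch_of_decides he).trans (branch_congr (fun _ _ => rfl) fun γ hγ => ?_).le
  refine ⟨fun h => hde.trans h, fun h => (he γ hγ).resolve_right fun h' => hd ?_⟩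
  exact disjoint_self.1 (h'.mono hde h)

theorem Decides.branch (h : ∀ γ < α, Decides d (y γ)) : Decides d (branch y ε α) :=
  Decides.iInf fun γ => Decides.iInf fun hγ => by
    split_ifs
    exacts [h γ hγ, (h γ hγ).compl]

theorem Decides.lexCut (h : ∀ γ ≤ α, Decides d (y γ)) : Decides d (lexCut y ε α) :=
  Decides.iSup fun β => Decides.iSup fun hβ =>
    (Decides.branch fun γ hγ => h γ (hγ.le.trans hβ.1)).inf (h β hβ.1).compl

theorem lexCut_le_of_forall_iff (hα : α ≤ β) (h : ∀ γ ≤ α, (γ ∈ ε ↔ γ ∈ ε')) :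
    lexCut y ε α ≤ lexCut y ε' β := by
  refine iSup₂_le fun γ hγ => ?_
  rw [branch_congr (fun _ _ => rfl) fun δ (hδ : δ < γ) => h δ (hδ.le.trans hγ.1)]
  exact le_iSup₂ (f := fun γ (_ : γ ≤ β ∧ γ ∈ ε') => branch y ε' γ ⊓ (y γ)ᶜ) γ
    ⟨hγ.1.trans hα, (h γ hγ.1).1 hγ.2⟩

/-- The first disagreement `δ` settles the comparison: a summand of the smaller cut at an index past
`δ` follows `ε'` up to `δ` and then lies below `(y δ)ᶜ`, hence within the summand of `ε'` at `δ`. -/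
theorem lexCut_le_of_lt (hβ : δ ≤ β) (h : ∀ γ < δ, (γ ∈ ε ↔ γ ∈ ε')) (hδ : δ ∉ ε)
    (hδ' : δ ∈ ε') : lexCut y ε α ≤ lexCut y ε' β := by
  refine iSup₂_le fun γ hγ => ?_
  rcases lt_trichotomy γ δ with hγδ | rfl | hγδ
  · rw [branch_congr (fun _ _ => rfl) fun ν (hν : ν < γ) => h ν (hν.trans hγδ)]
    exact le_iSup₂ (f := fun γ (_ : γ ≤ β ∧ γ ∈ ε') => branch y ε' γ ⊓ (y γ)ᶜ) γ
      ⟨hγδ.le.trans hβ, (h γ hγδ).1 hγ.2⟩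
  · exact absurd hγ.2 hδ
  · refine le_trans ?_ (le_iSup₂ (f := fun γ (_ : γ ≤ β ∧ γ ∈ ε') => branch y ε' γ ⊓ (y γ)ᶜ) δ
      ⟨hβ, hδ'⟩)
    rw [← branch_congr (fun _ _ => rfl) h]
    exact inf_le_left.trans (le_inf (branch_anti hγδ.le) (branch_le_compl hγδ hδ))

/-- Changing only the digit at `α` moves the cut by exactly one half of the branch. This is how `y
α` is recovered from the chain of cuts. -/
theorem lexCut_insert : lexCut y (insert α ε) α =
    lexCut y (ε \ {α}) α ⊔ (branch y ε α ⊓ (y α)ᶜ) := by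
  refine le_antisymm (iSup₂_le fun γ hγ => ?_) (sup_le ?_ ?_)
  · rcases hγ.1.lt_or_eq with h | rfl
    · refine le_trans ?_ le_sup_left
      rw [branch_congr (ε' := ε \ {α}) (fun _ _ => rfl) fun δ (hδ : δ < γ) => by
        simp [(hδ.trans h).ne]]
      exact le_iSup₂ (f := fun γ (_ : γ ≤ α ∧ γ ∈ ε \ {α}) => branch y (ε \ {α}) γ ⊓ (y γ)ᶜ) γ
        ⟨hγ.1, hγ.2.resolve_left h.ne, h.ne⟩
    · refine le_trans ?_ le_sup_right
      rw [branch_congr (ε' := ε) (fun _ _ => rfl) fun δ (hδ : δ < γ) => by simp [hδ.ne]]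
  · exact lexCut_le_of_lt le_rfl (fun γ hγ => by simp [hγ.ne]) (by simp) (mem_insert _ _)
  · rw [branch_congr (ε' := insert α ε) (fun _ _ => rfl)
      fun δ (hδ : δ < α) => by simp [hδ.ne]]
    exact le_iSup₂ (f := fun γ (_ : γ ≤ α ∧ γ ∈ insert α ε) =>
      branch y (insert α ε) γ ⊓ (y γ)ᶜ) α ⟨le_rfl, mem_insert _ _⟩

theorem disjoint_lexCut_branch : Disjoint (lexCut y (ε \ {α}) α) (branch y ε α) := by
  simp only [lexCut, iSup_disjoint_iff]
  intro γ hγ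
  have h : γ < α := lt_of_le_of_ne hγ.1 hγ.2.2
  exact disjoint_compl_left.mono inf_le_right (branch_le h hγ.2.1)

theorem isChain_range_lexCut [WellFoundedLT ι] :
    IsChain (· ≤ ·) (range fun p : Set ι × ι => lexCut y p.1 p.2) := by
  suffices key : ∀ (ε ε' : Set ι) (α β : ι), α ≤ β →
      lexCut y ε α ≤ lexCut y ε' β ∨ lexCut y ε' β ≤ lexCut y ε α by
    rintro _ ⟨⟨ε, α⟩, rfl⟩ _ ⟨⟨ε', β⟩, rfl⟩ -
    rcases le_total α β with h | h
    · exact key _ _ _ _ h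
    · exact (key _ _ _ _ h).symm
  intro ε ε' α β hαβ
  by_cases h : ∀ γ ≤ α, (γ ∈ ε ↔ γ ∈ ε')
  · exact Or.inl (lexCut_le_of_forall_iff hαβ h)
  · push Not at h
    obtain ⟨δ, ⟨hδα, hδ⟩, hmin⟩ := WellFounded.has_min (wellFounded_lt (α := ι))
      {γ | γ ≤ α ∧ ¬ (γ ∈ ε ↔ γ ∈ ε')} (by
        obtain ⟨γ, hγ, h⟩ := h
        exact ⟨γ, hγ, by tauto⟩)
    have hlt : ∀ γ < δ, (γ ∈ ε ↔ γ ∈ ε') := fun γ hγ => by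
      by_contra hcon
      exact hmin γ ⟨hγ.le.trans hδα, hcon⟩ hγ
    by_cases hm : δ ∈ ε
    · exact Or.inr (lexCut_le_of_lt hδα (fun γ hγ => (hlt γ hγ).symm) (by tauto) hm)
    · exact Or.inl (lexCut_le_of_lt (hδα.trans hαβ) hlt hm (by tauto))

/-- The differences of the members of `K` are dense. -/
def IntervalDense {A : Type*} [BooleanAlgebra A] (K : Set A) : Prop :=
  ∀ a ≠ ⊥, ∃ p ∈ K, ∃ q ∈ K, p < q ∧ q \ p ≤ a

/-- The members of the family `y` together with their complements are dense. -/
def LiteralsDense (y : ι → B) : Prop :=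
  ∀ a ≠ ⊥, ∃ α, ∃ c ≤ a, c ≠ ⊥ ∧ (c = y α ∨ c = (y α)ᶜ)

theorem MaxChainIn.intervalDense [WellFoundedLT ι] (hB : AlephZeroDistributive B)
    (hι : ∀ α : ι, (Iio α).Countable) (hy : LiteralsDense y) {K : Set B}
    (hK : MaxChainIn ⊥ ⊤ K) (hyK : ∀ ε α, lexCut y ε α ∈ K) : IntervalDense K := by
  intro a ha
  obtain ⟨α, c, hca, hc, hcy⟩ := hy a ha
  have hcy' : ∀ e, Decides e (y α) → Decides e c := fun e he => by
    rcases hcy with rfl | rfl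
    exacts [he, he.compl]
  have hIic : (Iic α).Countable := by
    rw [← Iio_insert]
    exact (hι α).insert α
  obtain ⟨d, hd, hdc, hdy⟩ := hB.exists_decides (hIic.image y) hc
  replace hdy : ∀ γ ≤ α, Decides d (y γ) := fun γ hγ => hdy _ ⟨γ, hγ, rfl⟩
  -- Uncountably many `ε` may occur here, but `d` decides every such cut because it decides the
  -- digits up to `α`.
  let F : Set B := {z | ∃ ε, ∃ γ ≤ α, z = lexCut y ε γ}
  have hFK : F ⊆ K := by
    rintro _ ⟨ε, γ, -, rfl⟩
    exact hyK ε γ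
  have hdF : ∀ z ∈ F, Decides d z := by
    rintro _ ⟨ε, γ, hγ, rfl⟩
    exact Decides.lexCut fun ν hν => hdy ν (hν.trans hγ)
  obtain ⟨p, hp, q, hq, hdqp, hF⟩ : ∃ p ∈ K, ∃ q ∈ K, d ≤ q \ p ∧ ∀ z ∈ F, z ≤ p ∨ q ≤ z := by
    refine ⟨sSup (insert ⊥ {e ∈ F | Disjoint d e}),
      hK.sSup_mem (insert_subset (hK.left_mem bot_le) fun e he => hFK he.1) (insert_nonempty _ _),
      sInf (insert ⊤ {e ∈ F | d ≤ e}),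
      hK.sInf_mem (insert_subset (hK.right_mem bot_le) fun e he => hFK he.1) (insert_nonempty _ _),
      ?_, fun e he => ?_⟩
    · refine le_sdiff.2 ⟨le_sInf ?_, disjoint_sSup_iff.2 ?_⟩
      · rintro e (rfl | he)
        exacts [le_top, he.2]
      · rintro e (rfl | he)
        exacts [disjoint_bot_right, he.2]
    · rcases hdF e he with h | h
      · exact Or.inr (sInf_le (Or.inr ⟨he, h⟩))
      · exact Or.inl (le_sSup (Or.inr ⟨he, h⟩))
  have hpq : ¬ q ≤ p := fun h => hd (le_bot_iff.1 (hdqp.trans (sdiff_eq_bot_iff.2 h).le))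
  have hdec : ∀ z ∈ F, Decides (q \ p) z := fun z hz => by
    rcases hF z hz with h | h
    · exact Or.inr (disjoint_sdiff_self_left.mono_right h)
    · exact Or.inl (sdiff_le.trans h)
  -- Once `q \ p` decides the earlier digits, it lies below the branch that `d` follows. It also
  -- decides the two cuts differing by the `(y γ)ᶜ` half of that branch, hence `y γ` itself.
  have hind : ∀ γ ≤ α, Decides (q \ p) (y γ) := by
    intro γ
    induction γ using WellFoundedLT.induction with
    | ind γ ih =>
      intro hγ
      have hle := le_branch_of_le hd hdqp fun ν hν => ih ν hν (hν.le.trans hγ)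
      have h1 := hdec _ ⟨insert γ {γ | d ≤ y γ}, γ, hγ, rfl⟩
      have h2 := hdec _ ⟨{γ | d ≤ y γ} \ {γ}, γ, hγ, rfl⟩
      rcases h1.sdiff h2 with h | h
      · rw [lexCut_insert, sup_sdiff_left_self] at h
        exact Or.inr (le_compl_iff_disjoint_right.1 (h.trans (sdiff_le.trans inf_le_right)))
      · have hdis : Disjoint (branch y {γ | d ≤ y γ} γ ⊓ (y γ)ᶜ)
            (lexCut y ({γ | d ≤ y γ} \ {γ}) γ) :=
          disjoint_lexCut_branch.symm.mono_left inf_le_left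
        rw [lexCut_insert, sup_sdiff_left_self, hdis.sdiff_eq_left] at h
        refine Or.inl ?_
        have h3 : Disjoint (q \ p) (y γ)ᶜ := by
          rw [disjoint_iff] at h ⊢
          rwa [← inf_assoc, inf_eq_left.2 hle] at h
        simpa using h3.le_compl_right
  refine ⟨p, hp, q, hq, lt_of_le_not_ge ((hK.chain.total hp hq).resolve_right hpq) hpq, ?_⟩
  exact ((hcy' _ (hind α le_rfl)).resolve_right fun h =>
    hd (disjoint_self.1 (h.mono hdqp hdc))).trans hca

/-- The indices `δ` at which `y δ` splits some branch. -/
def splitIndices (y : ι → B) : Set ι := {δ | ∃ ε, ¬ Decides (branch y ε δ) (y δ)}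

/-- A digit that splits no branch is decided once the earlier ones are. If only countably many
split, a single nonzero `d` would decide all digits and, these being dense up to complements, be an
atom. -/
theorem not_countable_splitIndices [WellFoundedLT ι] (hB : IsSouslinAlgebra B)
    (hy : LiteralsDense y) : ¬ (splitIndices y).Countable := by
  intro hN
  have := hB.nontrivial
  obtain ⟨d, hd, -, hdy⟩ := hB.distributive.exists_decides (hN.image y) (top_ne_bot (α := B))
  have hall : ∀ δ, Decides d (y δ) := by
    intro δ
    induction δ using WellFoundedLT.induction with
    | ind δ ih =>
      by_cases hδ : δ ∈ splitIndices y
      · exact hdy _ ⟨δ, hδ, rfl⟩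
      · have hδ' : ∀ ε, Decides (branch y ε δ) (y δ) := by simpa [splitIndices] using hδ
        exact (hδ' _).mono (le_branch_of_decides ih)
  obtain ⟨c, hc, hcd⟩ := hB.atomless.exists_lt hd
  obtain ⟨α, e, hec, he, hey⟩ := hy c hc
  have hde : Decides d e := by
    rcases hey with rfl | rfl
    exacts [hall α, (hall α).compl]
  rcases hde with h | h
  · exact hcd.not_ge (h.trans hec)
  · exact he (disjoint_self.1 (h.mono_left (hec.trans hcd.le)))

open Classical in
/-- The family `y` with the members indexed by `s` complemented. -/
noncomputable def flipOn (y : ι → B) (s : Set ι) (α : ι) : B := if α ∈ s then (y α)ᶜ else y α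

theorem LiteralsDense.flipOn {ι : Type u} {y : ι → B} (hy : LiteralsDense y) (s : Set ι) :
    LiteralsDense (_root_.flipOn y s) := by
  intro a ha
  obtain ⟨α, c, hca, hc, h⟩ := hy a ha
  refine ⟨α, c, hca, hc, ?_⟩
  by_cases hs : α ∈ s <;> simp [_root_.flipOn, hs] <;> tauto

theorem branch_flip (s : Set ι) : branch (flipOn y s) {γ | γ ∈ ε ↔ γ ∉ s} α = branch y ε α := by
  refine iInf_congr fun γ => iInf_congr fun hγ => ?_
  by_cases hs : γ ∈ s <;> by_cases hε : γ ∈ ε <;> simp [flipOn, hs, hε]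

/-- At the first difference `δ` the two families yield cuts `l ⊔ t ⊓ y δ` and `l ⊔ t ⊓ (y δ)ᶜ` with
the same `l` disjoint from the branch `t`. These are comparable only if `t` decides `y δ`. -/
theorem notMem_splitIndices_of_flipOn {s s' : Set ι} {K : Set B} (hK : IsChain (· ≤ ·) K)
    (h : ∀ ε α, lexCut (flipOn y s) ε α ∈ K) (h' : ∀ ε α, lexCut (flipOn y s') ε α ∈ K)
    (hlt : ∀ γ < δ, (γ ∈ s ↔ γ ∈ s')) (hs : δ ∈ s) (hs' : δ ∉ s') : δ ∉ splitIndices y := by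
  rintro ⟨ε₀, hε₀⟩
  -- Reversing the choices on `s` along with the digits keeps the branch of `ε₀`.
  let ε : Set ι := {γ | γ ∈ ε₀ ↔ γ ∉ s}
  have hflip : ∀ γ < δ, flipOn y s γ = flipOn y s' γ := fun γ hγ => by
    by_cases hγs : γ ∈ s
    · simp [flipOn, hγs, (hlt γ hγ).1 hγs]
    · have hγs' : γ ∉ s' := fun h => hγs ((hlt γ hγ).2 h)
      simp [flipOn, hγs, hγs']
  have hb : branch (flipOn y s) ε δ = branch y ε₀ δ := branch_flip s
  have hb' : branch (flipOn y s') ε δ = branch y ε₀ δ := by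
    rw [← hb]
    exact branch_congr (fun γ hγ => (hflip γ hγ).symm) fun _ _ => Iff.rfl
  have hL : lexCut (flipOn y s') (ε \ {δ}) δ = lexCut (flipOn y s) (ε \ {δ}) δ := by
    refine iSup_congr fun γ => iSup_congr fun hγ => ?_
    have hγδ : γ < δ := lt_of_le_of_ne hγ.1 hγ.2.2
    rw [hflip γ hγδ, branch_congr (fun ν (hν : ν < γ) => (hflip ν (hν.trans hγδ)).symm)
      fun _ _ => Iff.rfl]
  have hdis : Disjoint (lexCut (flipOn y s) (ε \ {δ}) δ) (branch y ε₀ δ) :=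
    hb ▸ disjoint_lexCut_branch
  have key : ∀ u v l t : B, Disjoint l t → Disjoint u v → l ⊔ t ⊓ u ≤ l ⊔ t ⊓ v →
      Disjoint t u := by
    intro u v l t hlt huv hle
    have h1 : t ⊓ u ≤ l ⊔ t ⊓ v := le_sup_right.trans hle
    have h2 : Disjoint (t ⊓ u) (l ⊔ t ⊓ v) :=
      (hlt.symm.mono_left inf_le_left).sup_right (huv.mono inf_le_right inf_le_right)
    exact disjoint_iff.2 (disjoint_self.1 (h2.mono_right h1))
  have h1 := h (insert δ ε) δ
  have h2 := h' (insert δ ε) δ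
  rw [lexCut_insert, hb, show flipOn y s δ = (y δ)ᶜ by simp [flipOn, hs], compl_compl] at h1
  rw [lexCut_insert, hb', hL, show flipOn y s' δ = y δ by simp [flipOn, hs']] at h2
  rcases hK.total h1 h2 with hle | hle
  · exact hε₀ (Or.inr (key _ _ _ _ hdis disjoint_compl_right hle))
  · refine hε₀ (Or.inl ?_)
    simpa using (key _ _ _ _ hdis disjoint_compl_left hle).le_compl_right

theorem IsSouslinAlgebra.exists_chains_of_literalsDense [WellFoundedLT ι]
    (hB : IsSouslinAlgebra B) (hι : ∀ α : ι, (Iio α).Countable) (hlit : LiteralsDense y) {o : ι}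
    (ho : ∀ α, o ≤ α) :
    ∃ (σ : Type u) (K : Set σ → Set B), Cardinal.aleph 1 ≤ #σ ∧ Function.Injective K ∧
      ∀ s, MaxChainIn ⊥ ⊤ (K s) ∧ (y o)ᶜ ∈ K s ∧ IntervalDense (K s) := by
  -- Excluding `o` keeps the first digit unreversed, so its cut `(y o)ᶜ` lies in every chain.
  let N := splitIndices y \ {o}
  have hN : Cardinal.aleph 1 ≤ #N := by
    rw [Cardinal.aleph_one_le_iff, ← not_le, Cardinal.le_aleph0_iff_set_countable]
    exact fun h => not_countable_splitIndices hB hlit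
      ((h.insert o).mono (by rw [insert_sdiff_singleton]; exact subset_insert _ _))
  have hex := fun s : Set N => exists_maxChainIn_of_isChain
    (isChain_range_lexCut (y := flipOn y (Subtype.val '' s)))
  choose K hK hyK using hex
  have hyK' : ∀ s ε α, lexCut (flipOn y (Subtype.val '' s)) ε α ∈ K s := fun s ε α =>
    hyK s ⟨(ε, α), rfl⟩
  refine ⟨N, K, hN, ?_, fun s => ⟨hK s, ?_, (hK s).intervalDense hB.distributive
    hι (hlit.flipOn _) (hyK' s)⟩⟩
  · intro s s' hss
    by_contra hne
    have hex : ∃ δ, ¬ (δ ∈ Subtype.val '' s ↔ δ ∈ Subtype.val '' s') := by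
      by_contra! hcon
      exact hne (Subtype.val_injective.image_injective (Set.ext hcon))
    obtain ⟨δ, hδ, hmin⟩ := WellFounded.has_min (wellFounded_lt (α := ι))
      {δ | ¬ (δ ∈ Subtype.val '' s ↔ δ ∈ Subtype.val '' s')} hex
    have hlt : ∀ γ < δ, (γ ∈ Subtype.val '' s ↔ γ ∈ Subtype.val '' s') := fun γ hγ => by
      by_contra hcon
      exact hmin γ hcon hγ
    have hsub : ∀ s : Set N, ∀ δ ∈ Subtype.val '' s, δ ∈ splitIndices y := by
      rintro s _ ⟨δ, -, rfl⟩
      exact δ.2.1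
    by_cases hm : δ ∈ Subtype.val '' s
    · have hm' : δ ∉ Subtype.val '' s' := fun h => hδ (iff_of_true hm h)
      exact notMem_splitIndices_of_flipOn (hK s).chain (hyK' s) (hss ▸ hyK' s') hlt hm hm' (hsub s δ hm)
    · have hm' : δ ∈ Subtype.val '' s' := by
        by_contra h
        exact hδ (iff_of_false hm h)
      exact notMem_splitIndices_of_flipOn (hK s').chain (hyK' s') (hss ▸ hyK' s)
        (fun γ hγ => (hlt γ hγ).symm) hm' hm (hsub s' δ hm')
  · have hos : o ∉ Subtype.val '' s := by
      rintro ⟨δ, -, h⟩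
      exact δ.2.2 h
    have h1 : flipOn y (Subtype.val '' s) o = y o := by simp only [flipOn, hos, if_false]
    have h2 : lexCut (flipOn y (Subtype.val '' s)) {o} o = (y o)ᶜ := by
      have hb : branch (flipOn y (Subtype.val '' s)) {o} o = ⊤ :=
        top_le_iff.1 (le_iInf₂ fun γ hγ => absurd hγ (ho γ).not_gt)
      refine le_antisymm (iSup₂_le ?_) ?_
      · rintro β ⟨-, rfl⟩
        rw [h1]
        exact inf_le_right
      · refine le_trans ?_ (le_iSup₂ (f := fun γ (_ : γ ≤ o ∧ γ ∈ ({o} : Set ι)) =>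
          branch (flipOn y (Subtype.val '' s)) {o} γ ⊓ (flipOn y (Subtype.val '' s) γ)ᶜ) o
          ⟨le_rfl, rfl⟩)
        rw [hb, h1, top_inf_eq]
    exact h2 ▸ hyK' s {o} o

/-- A Souslin algebra with a dense set of size `ℵ₁` has as many maximal chains with dense
differences through a given element as there are subsets of some uncountable set. -/
theorem IsSouslinAlgebra.exists_intervalDense_chains (hB : IsSouslinAlgebra B) {D : Set B}
    (hD : #D ≤ Cardinal.aleph 1) (hDdense : ∀ b ≠ ⊥, ∃ d ∈ D, d ≠ ⊥ ∧ d ≤ b) (x : B) :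
    ∃ (σ : Type u) (K : Set σ → Set B), Cardinal.aleph 1 ≤ #σ ∧ Function.Injective K ∧
      ∀ s, MaxChainIn ⊥ ⊤ (K s) ∧ x ∈ K s ∧ IntervalDense (K s) := by
  obtain ⟨y, hy, o, ho, hyo⟩ := exists_enumeration hD xᶜ
  have hlit : LiteralsDense y := fun b hb => by
    obtain ⟨d, hd, hd0, hdb⟩ := hDdense b hb
    obtain ⟨α, rfl⟩ := hy d hd
    exact ⟨α, _, hdb, hd0, Or.inl rfl⟩
  have h := hB.exists_chains_of_literalsDense countable_Iio_toType hlit ho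
  rwa [hyo, compl_compl] at h

end LexicographicCuts

/-! ### Small dense sets and the bounds they give. -/

section DenseSets

open Set

variable {B : Type u} [CompleteBooleanAlgebra B]

theorem exists_forall_mem_lt_of_countable {S : Set (Cardinal.aleph.{u} 1).ord.ToType}
    (hS : S.Countable) : ∃ α, ∀ γ ∈ S, γ < α := by
  by_contra! hcon
  have hcount : (univ : Set (Cardinal.aleph.{u} 1).ord.ToType).Countable := by
    refine (hS.biUnion (t := fun γ _ => Iic γ) fun γ _ => ?_).mono fun α _ => ?_
    · rw [← Iio_insert]
      exact (countable_Iio_toType γ).insert γ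
    · obtain ⟨γ, hγ, h⟩ := hcon α
      exact mem_biUnion hγ h
  have h := Cardinal.le_aleph0_iff_set_countable.2 hcount
  rw [Cardinal.mk_univ, Cardinal.mk_ord_toType] at h
  exact Cardinal.aleph0_lt_aleph_one.not_ge h

theorem CountableChainCondition.countable_branches {ι : Type u} [LinearOrder ι]
    (hB : CountableChainCondition B) (y : ι → B) (α : ι) :
    {z | ∃ ε, z = branch y ε α}.Countable := by
  refine hB _ ?_
  rintro _ ⟨ε, rfl⟩ _ ⟨ε', rfl⟩ hne
  have h : ∃ γ < α, ¬ (γ ∈ ε ↔ γ ∈ ε') := by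
    by_contra! hcon
    exact hne (branch_congr (fun _ _ => rfl) hcon)
  obtain ⟨γ, hγ, h⟩ := h
  by_cases hm : γ ∈ ε
  · exact disjoint_compl_right.mono (branch_le hγ hm) (branch_le_compl hγ (by tauto))
  · exact disjoint_compl_left.mono (branch_le_compl hγ hm) (branch_le hγ (by tauto))

/-- In a c.c.c. algebra, the elements that are determined by countably many members of `X` form a
complete subalgebra. -/
theorem CountableChainCondition.exists_countable_decides (hB : CountableChainCondition B)
    {X : Set B} {b : B} (hb : b ∈ completelyGenerated X) :
    ∃ S ⊆ X, S.Countable ∧ ∀ d, (∀ s ∈ S, Decides d s) → Decides d b := by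
  let P : B → Prop := fun b =>
    ∃ S ⊆ X, S.Countable ∧ ∀ d, (∀ s ∈ S, Decides d s) → Decides d b
  have hcompl : ∀ {a}, P a → P aᶜ := fun ⟨S, hSX, hS, h⟩ => ⟨S, hSX, hS, fun d hd => (h d hd).compl⟩
  have hsSup : ∀ T : Set B, (∀ t ∈ T, P t) → P (sSup T) := by
    intro T hT
    obtain ⟨T', hT', hc, hsup⟩ := hB.exists_countable_sSup_eq T
    have hT'' : ∀ t ∈ T', P t := fun t ht => hT t (hT' ht)
    choose! g hgX hgc hg using hT''
    refine ⟨⋃ t ∈ T', g t, iUnion₂_subset hgX, hc.biUnion hgc, fun d hd => ?_⟩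
    rw [← hsup]
    exact Decides.sSup fun t ht => hg t ht d fun s hs => hd s (mem_biUnion ht hs)
  have hsup : ∀ {a b}, P a → P b → P (a ⊔ b) := fun ha hb => by
    rw [← sSup_pair]
    exact hsSup _ (by rintro t (rfl | rfl); exacts [ha, hb])
  let A : BooleanSubalgebra B :=
    { carrier := {b | P b}
      supClosed' := fun a ha b hb => hsup ha hb
      infClosed' := fun a ha b hb => by
        have := hcompl (hsup (hcompl ha) (hcompl hb))
        rwa [compl_sup, compl_compl, compl_compl] at this
      compl_mem' := hcompl
      bot_mem' := by
        have := hsSup ∅ (by simp)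
        rwa [sSup_empty] at this }
  have hle : completelyGenerated X ≤ A := sInf_le
    ⟨hsSup, fun x hx => ⟨{x}, by simpa, countable_singleton x, fun d hd => hd x rfl⟩⟩
  exact hle hb

/-- Countably many generators decide `b`, so every branch of some countable length decides it, and
one of them lies below `b`. By the c.c.c. each length has only countably many branches. -/
theorem IsSmallAlgebra.exists_dense (hB : IsSouslinAlgebra B) (hsmall : IsSmallAlgebra B) :
    ∃ D : Set B, #D ≤ Cardinal.aleph 1 ∧ ∀ b ≠ ⊥, ∃ d ∈ D, d ≠ ⊥ ∧ d ≤ b := by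
  obtain ⟨X, hX, hgen⟩ := hsmall
  obtain ⟨y, hy, o, -⟩ := exists_enumeration hX.le ⊥
  refine ⟨⋃ α, {z | ∃ ε, z = branch y ε α}, ?_, fun b hb => ?_⟩
  · refine (Cardinal.mk_iUnion_le _).trans (Cardinal.mul_le_of_le (Cardinal.aleph0_le_aleph 1)
      (Cardinal.mk_ord_toType _).le (ciSup_le' fun α => ?_))
    exact (Cardinal.le_aleph0_iff_set_countable.2 (hB.ccc.countable_branches y α)).trans
      (Cardinal.aleph0_le_aleph 1)
  · obtain ⟨S, hSX, hS, hSb⟩ := hB.ccc.exists_countable_decides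
      (show b ∈ completelyGenerated X from hgen ▸ BooleanSubalgebra.mem_top)
    have : Nonempty (Cardinal.aleph.{u} 1).ord.ToType := ⟨o⟩
    choose! g hg using hy
    obtain ⟨α, hα⟩ := exists_forall_mem_lt_of_countable (hS.image g)
    obtain ⟨d, hd, hdb, hdy⟩ := hB.distributive.exists_decides
      ((countable_Iio_toType α).image y) hb
    have hdz := le_branch_of_decides (y := y) (α := α) fun γ hγ => hdy _ ⟨γ, hγ, rfl⟩
    refine ⟨_, mem_iUnion.2 ⟨α, _, rfl⟩, fun h => hd (le_bot_iff.1 (h ▸ hdz)), ?_⟩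
    refine (hSb _ fun s hs => ?_).resolve_right fun h => hd (disjoint_self.1 (h.mono hdz hdb))
    have hlt := hα _ ⟨s, hs, rfl⟩
    rw [← hg s (hSX hs)]
    by_cases hm : g s ∈ {γ | d ≤ y γ}
    · exact Or.inl (branch_le hlt hm)
    · exact Or.inr (disjoint_compl_left.mono_left (branch_le_compl hlt hm))

theorem mk_le_of_dense {A : Type u} [BooleanAlgebra A] {D : Set A}
    (hD : ∀ b ≠ ⊥, ∃ d ∈ D, d ≠ ⊥ ∧ d ≤ b) : #A ≤ 2 ^ #D := by
  have key : ∀ a b : A, (∀ d : D, (d : A) ≤ a → (d : A) ≤ b) → a ≤ b := by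
    intro a b h
    by_contra hab
    obtain ⟨d, hd, hd0, hdab⟩ := hD (a \ b) fun h => hab (sdiff_eq_bot_iff.1 h)
    have h1 := h ⟨d, hd⟩ (hdab.trans sdiff_le)
    exact hd0 (disjoint_self.1 (disjoint_sdiff_self_left.mono hdab h1))
  rw [← Cardinal.mk_set]
  refine Cardinal.mk_le_of_injective (f := fun a : A => {d : D | (d : A) ≤ a}) fun a b hab => ?_
  exact le_antisymm (key _ _ fun d hd => (Set.ext_iff.1 hab d).1 hd)
    (key _ _ fun d hd => (Set.ext_iff.1 hab d).2 hd)

theorem OrderIso.eq_of_eqOn_dense {A A' : Type u} [BooleanAlgebra A] [BooleanAlgebra A'] {D : Set A}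
    (hD : ∀ b ≠ ⊥, ∃ d ∈ D, d ≠ ⊥ ∧ d ≤ b) {φ ψ : A ≃o A'} (h : ∀ d ∈ D, φ d = ψ d) : φ = ψ := by
  have key : ∀ φ ψ : A ≃o A', (∀ d ∈ D, φ d = ψ d) → ∀ a, φ a ≤ ψ a := by
    intro φ ψ h a
    by_contra hcon
    obtain ⟨d, hd, hd0, hda⟩ := hD (φ.symm (φ a \ ψ a)) fun h => by
      rw [map_eq_bot_iff] at h
      exact hcon (sdiff_eq_bot_iff.1 h)
    have h1 : φ d ≤ φ a \ ψ a := φ.le_symm_apply.1 hda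
    have h2 : d ≤ a := φ.le_iff_le.1 (h1.trans sdiff_le)
    have h3 : φ d ≤ ψ a := h d hd ▸ ψ.monotone h2
    have h4 : φ d = ⊥ := disjoint_self.1 (disjoint_sdiff_self_left.mono h1 h3)
    exact hd0 ((map_eq_bot_iff φ).1 h4)
  exact OrderIso.ext (funext fun a => le_antisymm (key φ ψ h a)
    (key ψ φ (fun d hd => (h d hd).symm) a))

end DenseSets

/-! ### Extending chain isomorphisms to algebra isomorphisms. -/

section Extension

open Set

variable {A A' : Type u} [CompleteBooleanAlgebra A] [CompleteBooleanAlgebra A']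

/-- Dense families with the same disjointness relation generate isomorphic algebras. -/
theorem exists_orderIso_of_dense_families {ι : Type*} {e : ι → A} {e' : ι → A'}
    (he : ∀ i, e i ≠ ⊥) (he' : ∀ i, e' i ≠ ⊥)
    (hd : ∀ a ≠ ⊥, ∃ i, e i ≤ a) (hd' : ∀ a ≠ ⊥, ∃ i, e' i ≤ a)
    (h : ∀ i j, Disjoint (e i) (e j) ↔ Disjoint (e' i) (e' j)) :
    ∃ φ : A ≃o A', ∀ a i, e' i ≤ φ a ↔ e i ≤ a := by
  have aux : ∀ {A A' : Type u} [CompleteBooleanAlgebra A] [CompleteBooleanAlgebra A']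
      {e : ι → A} {e' : ι → A'}, (∀ i, e' i ≠ ⊥) → (∀ a ≠ ⊥, ∃ i, e i ≤ a) →
      (∀ i j, Disjoint (e i) (e j) ↔ Disjoint (e' i) (e' j)) → (∀ i, e i ≠ ⊥) →
      (∀ a j, e' j ≤ (⨆ i, ⨆ _ : e i ≤ a, e' i) ↔ e j ≤ a) ∧
        ∀ a, (⨆ i, ⨆ _ : e i ≤ a, e i) = a := by
    intro A A' _ _ e e' he' hd h he
    refine ⟨fun a j => ⟨fun hj => ?_, fun hj => le_iSup₂ (f := fun i (_ : e i ≤ a) => e' i) j hj⟩,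
      fun a => ?_⟩
    · by_contra hja
      -- This `e i` is disjoint from all `e k ≤ a`, so `e' i` is disjoint from the join that is
      -- assumed to contain `e' j`; transferring back, `e i` is disjoint from `e j`, although it
      -- lies below it.
      obtain ⟨i, hi⟩ := hd (e j \ a) fun h => hja (sdiff_eq_bot_iff.1 h)
      have h1 : Disjoint (e' i) (⨆ i, ⨆ _ : e i ≤ a, e' i) := by
        simp only [disjoint_iSup_iff]
        exact fun k hk => (h i k).1 (disjoint_sdiff_self_left.mono hi hk)
      have h2 : Disjoint (e i) (e j) := (h i j).2 (h1.mono_right hj)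
      exact he i (disjoint_self.1 (h2.mono_right (hi.trans sdiff_le)))
    · refine le_antisymm (iSup₂_le fun _ hi => hi) ?_
      by_contra hcon
      obtain ⟨i, hi⟩ := hd (a \ ⨆ i, ⨆ _ : e i ≤ a, e i) fun h => hcon (sdiff_eq_bot_iff.1 h)
      have h1 := le_iSup₂ (f := fun i (_ : e i ≤ a) => e i) i (hi.trans sdiff_le)
      exact he i (disjoint_self.1 (disjoint_sdiff_self_left.mono hi h1))
  obtain ⟨h1, h2⟩ := aux he' hd h he
  obtain ⟨h1', h2'⟩ := aux he hd' (fun i j => (h i j).symm) he'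
  refine ⟨⟨⟨fun a => ⨆ i, ⨆ _ : e i ≤ a, e' i, fun a => ⨆ i, ⨆ _ : e' i ≤ a, e i,
    fun a => ?_, fun a => ?_⟩, ?_⟩, h1⟩
  · simp only [h1]
    exact h2 a
  · simp only [h1']
    exact h2' a
  · intro a b
    refine ⟨fun hab => ?_, fun hab => iSup₂_le fun i hi =>
      le_iSup₂ (f := fun i (_ : e i ≤ b) => e' i) i (hi.trans hab)⟩
    rw [← h2 a]
    exact iSup₂_le fun i hi => (h1 b i).1 (((h1 a i).2 hi).trans hab)

/-- The right side mentions only the order of the chain, so an order isomorphism of chains preserves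
disjointness of differences. -/
theorem IsChain.disjoint_sdiff_sdiff_iff {A : Type*} [BooleanAlgebra A] {K : Set A}
    (hK : IsChain (· ≤ ·) K) {p q r s : A}
    (hp : p ∈ K) (hq : q ∈ K) (hr : r ∈ K) (hs : s ∈ K) :
    Disjoint (q \ p) (s \ r) ↔ q ≤ p ∨ q ≤ r ∨ s ≤ p ∨ s ≤ r := by
  constructor
  · intro h
    have h1 : q ⊓ s ≤ p ⊔ r := by
      rw [← sdiff_eq_bot_iff, ← le_bot_iff]
      refine h (sdiff_le_sdiff inf_le_left le_sup_left) (sdiff_le_sdiff inf_le_right le_sup_right)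
    rcases hK.total hq hs with h2 | h2 <;> rcases hK.total hp hr with h3 | h3 <;>
      simp only [h2, h3, inf_eq_left.2, inf_eq_right.2, sup_eq_left.2, sup_eq_right.2] at h1 <;>
      tauto
  · rintro (h | h | h | h)
    · rw [sdiff_eq_bot_iff.2 h]
      exact disjoint_bot_left
    · exact disjoint_sdiff_self_right.mono_left (sdiff_le.trans h)
    · exact disjoint_sdiff_self_left.mono_right (sdiff_le.trans h)
    · rw [sdiff_eq_bot_iff.2 h]
      exact disjoint_bot_right

theorem IsChain.sdiff_le_iff {A : Type*} [BooleanAlgebra A] {K : Set A}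
    (hK : IsChain (· ≤ ·) K) {p q r : A} (hp : p ∈ K) (hr : r ∈ K) :
    q \ p ≤ r ↔ q ≤ p ∨ q ≤ r := by
  rw [_root_.sdiff_le_iff]
  refine ⟨fun h => ?_, fun h => h.elim le_sup_of_le_left le_sup_of_le_right⟩
  rcases hK.total hp hr with h1 | h1
  · exact Or.inr (sup_eq_right.2 h1 ▸ h)
  · exact Or.inl (sup_eq_left.2 h1 ▸ h)

theorem exists_orderIso_extend {K : Set A} {K' : Set A'} (hK : IsChain (· ≤ ·) K)
    (hK' : IsChain (· ≤ ·) K') (hd : IntervalDense K) (hd' : IntervalDense K') (f : K ≃o K') :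
    ∃ φ : A ≃o A', ∀ k : K, φ k = f k := by
  let ι := {i : K × K // i.1 < i.2}
  let e : ι → A := fun i => (i.1.2 : A) \ i.1.1
  let e' : ι → A' := fun i => (f i.1.2 : A') \ f i.1.1
  have he' : ∀ i, e' i ≠ ⊥ := fun i h =>
    (f.lt_iff_lt.2 i.2).not_ge (show f i.1.2 ≤ f i.1.1 from sdiff_eq_bot_iff.1 h)
  have hde' : ∀ a ≠ ⊥, ∃ i, e' i ≤ a := fun a ha => by
    obtain ⟨p, hp, q, hq, hpq, h⟩ := hd' a ha
    refine ⟨⟨(f.symm ⟨p, hp⟩, f.symm ⟨q, hq⟩), f.symm.lt_iff_lt.2 hpq⟩, ?_⟩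
    simpa [e'] using h
  have hf : ∀ x y : K, (f x : A') ≤ f y ↔ (x : A) ≤ y := fun x y => f.le_iff_le
  obtain ⟨φ, hφ⟩ := exists_orderIso_of_dense_families (e := e) (e' := e')
    (fun i h => i.2.not_ge (show i.1.2 ≤ i.1.1 from sdiff_eq_bot_iff.1 h)) he'
    (fun a ha => by
      obtain ⟨p, hp, q, hq, hpq, h⟩ := hd a ha
      exact ⟨⟨(⟨p, hp⟩, ⟨q, hq⟩), hpq⟩, h⟩)
    hde'
    (fun i j => by
      simp only [e, e']
      rw [hK.disjoint_sdiff_sdiff_iff i.1.1.2 i.1.2.2 j.1.1.2 j.1.2.2,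
        hK'.disjoint_sdiff_sdiff_iff (f _).2 (f _).2 (f _).2 (f _).2, hf, hf, hf, hf])
  refine ⟨φ, fun k => ?_⟩
  have hdet : ∀ a b : A', (∀ i, e' i ≤ a → e' i ≤ b) → a ≤ b := by
    intro a b h
    by_contra hab
    obtain ⟨i, hi⟩ := hde' (a \ b) fun h => hab (sdiff_eq_bot_iff.1 h)
    exact he' i (disjoint_self.1
      (disjoint_sdiff_self_left.mono hi (h i (hi.trans sdiff_le))))
  have hiff : ∀ i, e' i ≤ φ k ↔ e' i ≤ f k := fun i => by
    rw [hφ]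
    simp only [e, e']
    rw [hK.sdiff_le_iff i.1.1.2 k.2, hK'.sdiff_le_iff (f _).2 (f _).2, hf, hf]
  exact le_antisymm (hdet _ _ fun i => (hiff i).1) (hdet _ _ fun i => (hiff i).2)

end Extension

/-! ### Souslin subalgebras and their maximal chains. -/

section Subalgebras

open Set

variable {B : Type u} [CompleteBooleanAlgebra B] {A : BooleanSubalgebra B}

theorem IsCompleteSubalgebra.sInf_mem (hA : IsCompleteSubalgebra A) {S : Set B}
    (hS : S ⊆ (A : Set B)) : sInf S ∈ A := by
  rw [← BooleanSubalgebra.compl_mem_iff, compl_sInf']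
  exact hA _ (by rintro _ ⟨s, hs, rfl⟩; exact BooleanSubalgebra.compl_mem (hS hs))

/-- The complete Boolean algebra structure of a complete subalgebra. -/
@[reducible] noncomputable def IsCompleteSubalgebra.completeBooleanAlgebra
    (hA : IsCompleteSubalgebra A) : CompleteBooleanAlgebra A where
  __ := (inferInstance : BooleanAlgebra A)
  sSup S := ⟨sSup (Subtype.val '' S), hA _ (by rintro _ ⟨s, -, rfl⟩; exact s.2)⟩
  sInf S := ⟨sInf (Subtype.val '' S), hA.sInf_mem (by rintro _ ⟨s, -, rfl⟩; exact s.2)⟩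
  isLUB_sSup S := ⟨fun s hs => le_sSup (a := (s : B)) ⟨s, hs, rfl⟩,
    fun b hb => sSup_le (a := (b : B)) (by rintro _ ⟨s, hs, rfl⟩; exact hb hs)⟩
  isGLB_sInf S := ⟨fun s hs => sInf_le (a := (s : B)) ⟨s, hs, rfl⟩,
    fun b hb => le_sInf (a := (b : B)) (by rintro _ ⟨s, hs, rfl⟩; exact hb hs)⟩

theorem IsSouslinSubalgebra.isSouslinAlgebra (hB : IsSouslinAlgebra B)
    (hA : IsSouslinSubalgebra A) :
    @IsSouslinAlgebra A hA.complete.completeBooleanAlgebra := by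
  let _ := hA.complete.completeBooleanAlgebra
  have hiSup : ∀ {ι : Type u} (f : ι → A), ((⨆ i, f i : A) : B) = ⨆ i, (f i : B) := fun f => by
    change sSup (Subtype.val '' range f) = sSup (range fun i => (f i : B))
    rw [← range_comp]
    rfl
  have hiInf : ∀ (f : ℕ → A), ((⨅ i, f i : A) : B) = ⨅ i, (f i : B) := fun f => by
    change sInf (Subtype.val '' range f) = sInf (range fun i => (f i : B))
    rw [← range_comp]
    rfl
  have := hB.nontrivial
  refine ⟨⟨⊥, ⊤, fun h => bot_ne_top (congrArg Subtype.val h : (⊥ : B) = ⊤)⟩, hA.atomless, ?_, ?_⟩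
  · intro X hX
    refine (countable_of_injective_of_countable_image Subtype.val_injective.injOn
      (hB.ccc (Subtype.val '' X) ?_))
    rintro _ ⟨a, ha, rfl⟩ _ ⟨b, hb, rfl⟩ hab
    have h := hX ha hb fun h => hab (congrArg _ h)
    rw [Function.onFun, id, id, disjoint_iff] at h ⊢
    exact congrArg Subtype.val h
  · intro J a
    apply Subtype.ext
    simp only [hiInf, hiSup]
    exact hB.distributive J _

/-- Project each `d` upwards to the least element of `A` above it; if `d` lies below a member of
`A`, so does its projection. -/
theorem IsSouslinSubalgebra.exists_dense (hA : IsSouslinSubalgebra A) {D : Set B}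
    (hD : ∀ b ≠ ⊥, ∃ d ∈ D, d ≠ ⊥ ∧ d ≤ b) :
    ∃ E : Set A, #E ≤ #D ∧ ∀ a ≠ ⊥, ∃ e ∈ E, e ≠ ⊥ ∧ e ≤ a := by
  let π : D → A := fun d => ⟨sInf {a | a ∈ A ∧ (d : B) ≤ a}, hA.complete.sInf_mem fun a ha => ha.1⟩
  refine ⟨range π, Cardinal.mk_range_le, fun a ha => ?_⟩
  obtain ⟨d, hd, hd0, hda⟩ := hD a fun h => ha (Subtype.ext h)
  refine ⟨_, ⟨⟨d, hd⟩, rfl⟩, fun h => hd0 (le_bot_iff.1 ?_), sInf_le ⟨a.2, hda⟩⟩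
  have h1 : d ≤ sInf {a | a ∈ A ∧ d ≤ a} := le_sInf fun a ha => ha.2
  exact h1.trans (congrArg Subtype.val h).le

/-- Maximal chains of Souslin subalgebras are maximal in the big algebra. -/
theorem IsSouslinSubalgebra.maxChainIn_image (hA : IsSouslinSubalgebra A) {K : Set A}
    (hK : MaxChainIn ⊥ ⊤ K) : MaxChainIn (⊥ : B) ⊤ (Subtype.val '' K) := by
  let _ := hA.complete.completeBooleanAlgebra
  refine ⟨fun z _ => ⟨bot_le, le_top⟩, ?_, fun z _ hz => ?_⟩
  · rintro _ ⟨a, ha, rfl⟩ _ ⟨b, hb, rfl⟩ -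
    exact hK.chain.total ha hb
  · replace hz : ∀ k ∈ K, z ≤ (k : B) ∨ (k : B) ≤ z := fun k hk => hz _ ⟨k, hk, rfl⟩
    have hp := hK.sSup_mem (S := {k ∈ K | (k : B) ≤ z}) (fun k hk => hk.1)
      ⟨⊥, hK.left_mem bot_le, bot_le⟩
    have hq := hK.sInf_mem (S := {k ∈ K | z ≤ (k : B)}) (fun k hk => hk.1)
      ⟨⊤, hK.right_mem bot_le, le_top⟩
    have hpz : (sSup {k ∈ K | (k : B) ≤ z}).val ≤ z :=
      sSup_le (by rintro _ ⟨k, hk, rfl⟩; exact hk.2)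
    have hzq : z ≤ (sInf {k ∈ K | z ≤ (k : B)}).val :=
      le_sInf (by rintro _ ⟨k, hk, rfl⟩; exact hk.2)
    set p := sSup {k ∈ K | (k : B) ≤ z}
    set q := sInf {k ∈ K | z ≤ (k : B)}
    have hpq : p ≤ q := hpz.trans hzq
    -- Every member of `K` is below `p` or above `q`. If `p < q`, atomlessness of `A` gives an
    -- element `p ⊔ c` strictly between them, which maximality puts into `K`.
    have hqp : q ≤ p := by
      by_contra hcon
      obtain ⟨c, hc, hcqp⟩ := Atomless.exists_lt (B := A) hA.atomless (b := q \ p)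
        fun h => hcon (sdiff_eq_bot_iff.1 h)
      have hcp : Disjoint c p := disjoint_sdiff_self_left.mono_left hcqp.le
      have hr : p ⊔ c ∈ K := by
        refine hK.maximal _ ⟨bot_le, le_top⟩ fun k hk => ?_
        rcases hz k hk with h | h
        · exact Or.inl ((sup_le hpq (hcqp.le.trans sdiff_le)).trans (sInf_le ⟨hk, h⟩))
        · exact Or.inr ((le_sSup (a := k) ⟨hk, h⟩ : k ≤ p).trans le_sup_left)
      rcases hz _ hr with h | h
      · have h1 : q ≤ p ⊔ c := sInf_le ⟨hr, h⟩
        exact hcqp.not_ge (sdiff_le_iff.2 h1)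
      · have h1 : p ⊔ c ≤ p := le_sSup ⟨hr, h⟩
        exact hc (disjoint_self.1 (hcp.mono_right (le_sup_right.trans h1)))
    have : z = p := le_antisymm (hzq.trans hqp) hpz
    exact ⟨p, hp, this.symm⟩


theorem IsSouslinSubalgebra.exists_intervalDense_chains (hB : IsSouslinAlgebra B)
    (hsmall : IsSmallAlgebra B) (hA : IsSouslinSubalgebra A) (x : A) :
    ∃ (σ : Type u) (K : Set σ → Set A), Cardinal.aleph 1 ≤ #σ ∧ Function.Injective K ∧
      ∀ s, MaxChainIn ⊥ ⊤ (K s) ∧ x ∈ K s ∧ IntervalDense (K s) := by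
  obtain ⟨D, hDc, hD⟩ := hsmall.exists_dense hB
  obtain ⟨E, hE, hE'⟩ := hA.exists_dense hD
  exact @IsSouslinAlgebra.exists_intervalDense_chains A hA.complete.completeBooleanAlgebra
    (hA.isSouslinAlgebra hB) E (hE.trans hDc) hE' x

theorem IsSouslinSubalgebra.exists_orderIso_image_eq (hB : IsSouslinAlgebra B)
    (hchain : ChainHomogeneous B) {A₀ A₁ : BooleanSubalgebra B}
    (hA₀ : IsSouslinSubalgebra A₀) (hA₁ : IsSouslinSubalgebra A₁) {x : A₀} {y : A₁}
    (hx₀ : ⊥ < x) (hx₁ : x < ⊤) (hy₀ : ⊥ < y) (hy₁ : y < ⊤) {K₀ : Set A₀} {K₁ : Set A₁}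
    (hK₀ : MaxChainIn ⊥ ⊤ K₀) (hK₁ : MaxChainIn ⊥ ⊤ K₁) (hxK : x ∈ K₀) (hyK : y ∈ K₁)
    (hd₀ : IntervalDense K₀) (hd₁ : IntervalDense K₁) :
    ∃ φ : A₀ ≃o A₁, φ x = y ∧ φ '' K₀ = K₁ := by
  obtain ⟨f, hf⟩ := hB.exists_orderIso_map_eq hchain (hA₀.maxChainIn_image hK₀)
    (hA₁.maxChainIn_image hK₁) ⟨x, hxK, rfl⟩ ⟨y, hyK, rfl⟩ hx₀ hx₁ hy₀ hy₁
  have e : ∀ {A : BooleanSubalgebra B} (K : Set A),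
      ∃ e : K ≃o (Subtype.val '' K : Set B), ∀ k : K, (e k : B) = k.1.1 := fun K =>
    ⟨⟨Equiv.Set.image _ K Subtype.val_injective, Iff.rfl⟩, fun _ => rfl⟩
  obtain ⟨e₀, he₀⟩ := e K₀
  obtain ⟨e₁, he₁⟩ := e K₁
  let g : K₀ ≃o K₁ := e₀.trans (f.trans e₁.symm)
  obtain ⟨φ, hφ⟩ := @exists_orderIso_extend A₀ A₁ hA₀.complete.completeBooleanAlgebra
    hA₁.complete.completeBooleanAlgebra K₀ K₁ hK₀.chain hK₁.chain hd₀ hd₁ g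
  refine ⟨φ, ?_, ?_⟩
  · have h1 : φ x = g ⟨x, hxK⟩ := hφ ⟨x, hxK⟩
    have h2 : e₁ (g ⟨x, hxK⟩) = f (e₀ ⟨x, hxK⟩) := e₁.apply_symm_apply _
    have h3 : e₀ ⟨x, hxK⟩ = ⟨x, x, hxK, rfl⟩ := Subtype.ext (he₀ _)
    apply Subtype.ext
    rw [h1, ← he₁, h2, h3, hf]
  · refine Subset.antisymm ?_ fun k hk => ?_
    · rintro _ ⟨k, hk, rfl⟩
      have h1 : φ k = g ⟨k, hk⟩ := hφ ⟨k, hk⟩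
      exact h1 ▸ (g _).2
    · refine ⟨g.symm ⟨k, hk⟩, (g.symm _).2, ?_⟩
      have h1 : φ (g.symm ⟨k, hk⟩) = g (g.symm ⟨k, hk⟩) := hφ _
      rw [h1, OrderIso.apply_symm_apply]

end Subalgebras

/-! ### Counting the isomorphisms. -/

theorem proposition6p1 {B : Type u} [CompleteBooleanAlgebra B]
    (hB : IsSouslinAlgebra B) (hsmall : IsSmallAlgebra B) (hchain : ChainHomogeneous B)
    (A₀ A₁ : BooleanSubalgebra B)
    (hA₀ : IsSouslinSubalgebra A₀) (hA₁ : IsSouslinSubalgebra A₁)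
    (x : A₀) (y : A₁) (hx₀ : ⊥ < x) (hx₁ : x < ⊤) (hy₀ : ⊥ < y) (hy₁ : y < ⊤) :
    #{φ : A₀ ≃o A₁ // φ x = y} = 2 ^ Cardinal.aleph.{u} 1 := by
  apply le_antisymm
  · obtain ⟨D, hDc, hD⟩ := hsmall.exists_dense hB
    obtain ⟨E₀, hE₀, hE₀'⟩ := hA₀.exists_dense hD
    obtain ⟨E₁, hE₁, hE₁'⟩ := hA₁.exists_dense hD
    have hinj : Function.Injective fun (φ : {φ : A₀ ≃o A₁ // φ x = y}) (d : E₀) => φ.1 d :=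
      fun φ ψ h => Subtype.ext <| OrderIso.eq_of_eqOn_dense hE₀' fun d hd => congrFun h ⟨d, hd⟩
    have hA₁c : #A₁ ≤ 2 ^ Cardinal.aleph.{u} 1 := (mk_le_of_dense hE₁').trans
      (Cardinal.power_le_power_left two_ne_zero (hE₁.trans hDc))
    calc #{φ : A₀ ≃o A₁ // φ x = y} ≤ #(E₀ → A₁) := Cardinal.mk_le_of_injective hinj
      _ = #A₁ ^ #E₀ := (Cardinal.power_def _ _).symm
      _ ≤ (2 ^ Cardinal.aleph.{u} 1) ^ #E₀ := Cardinal.power_le_power_right hA₁c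
      _ ≤ (2 ^ Cardinal.aleph.{u} 1) ^ Cardinal.aleph.{u} 1 :=
        Cardinal.power_le_power_left (Cardinal.power_ne_zero _ two_ne_zero) (hE₀.trans hDc)
      _ = 2 ^ Cardinal.aleph.{u} 1 := by
        rw [← Cardinal.power_mul, Cardinal.mul_eq_self (Cardinal.aleph0_le_aleph 1)]
  -- On the side of `A₀` a single chain suffices, so `∅` is an arbitrary index. Since `φ s` carries
  -- that chain onto `K s`, injectivity of `K` makes the `φ s` distinct.
  · obtain ⟨σ₀, K₀, -, -, hK₀⟩ := hA₀.exists_intervalDense_chains hB hsmall x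
    obtain ⟨σ, K, hσ, hK, hK₁⟩ := hA₁.exists_intervalDense_chains hB hsmall y
    obtain ⟨h0, hx, hd0⟩ := hK₀ ∅
    have hex : ∀ s, ∃ φ : A₀ ≃o A₁, φ x = y ∧ φ '' K₀ ∅ = K s := fun s =>
      hA₀.exists_orderIso_image_eq hB hchain hA₁ hx₀ hx₁ hy₀ hy₁ h0 (hK₁ s).1 hx (hK₁ s).2.1
        hd0 (hK₁ s).2.2
    choose φ hφ hφK using hex
    calc 2 ^ Cardinal.aleph.{u} 1 ≤ 2 ^ #σ := Cardinal.power_le_power_left two_ne_zero hσ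
      _ = #(Set σ) := Cardinal.mk_set.symm
      _ ≤ #{φ : A₀ ≃o A₁ // φ x = y} := Cardinal.mk_le_of_injective
        (f := fun s => ⟨φ s, hφ s⟩) fun s t hst => hK <| by
          rw [← hφK s, ← hφK t, show φ s = φ t from congrArg Subtype.val hst]
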